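/- Let $m\ge 1$, $n=2m$, $q=2^n$, let $k$ be an integer with $1\le k\le n-1$ and $k\ne m$, and put $d=\gcd(m,k)$, $d'=\gcd(m+k,2k)$. Let $\mathbb F_{2^m}\subset\mathbb F_q$ be the finite fields with $2^m$ and $q$ elements, with absolute traces $\mathrm{Tr}_1^m:\mathbb F_{2^m}\to\mathbb F_2$ and $\mathrm{Tr}_1^n:\mathbb F_q\to\mathbb F_2$, and let $\pi$ be a primitive element of $\mathbb F_q$. For $\alpha\in\mathbb F_{2^m}$ and $\beta\in\mathbb F_q$ put \[T(\alpha,\beta)=\sum_{x\in\mathbb F_q}(-1)^{\mathrm{Tr}_1^m(\alpha x^{2^m+1})+\mathrm{Tr}_1^n(\beta x^{2^k+1})},\qquad c(\alpha,\beta)=\bigl(\mathrm{Tr}_1^m(\alpha\pi^{i(2^m+1)})+\mathrm{Tr}_1^n(\beta\pi^{i(2^k+1)})\bigr)_{i=0}^{q-2}.\] Let $\mathcal C_1$ be the binary cyclic code of length $q-1$ with parity-check polynomial $h_2h_3$, where $h_2,h_3$ are the minimal polynomials over $\mathbb F_2$ of $\pi^{-(2^k+1)}$ and $\pi^{-(2^m+1)}$;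 that is, the set of words $(c_0,\dots,c_{q-2})\in\mathbb F_2^{q-1}$ such that $x^{q-1}-1$ divides $h_2(x)h_3(x)\sum_i c_ix^i$. Then $(\alpha,\beta)\mapsto c(\alpha,\beta)$ is a bijection from $\mathbb F_{2^m}\times\mathbb F_q$ onto $\mathcal C_1$, and the value distribution of the multiset $\{T(\alpha,\beta):\alpha\in\mathbb F_{2^m},\beta\in\mathbb F_q\}$ and the weight distribution of $\mathcal C_1$ are as follows. In each row, the first entry is the value of $T(\alpha,\beta)$, the second is the Hamming weight of $c(\alpha,\beta)$ for the pairs $(\alpha,\beta)$ with this value, and the third is both the number of pairs $(\alpha,\beta)$ with this value and the number of codewords of $\mathcal C_1$ with this weight. No other values and no other weights occur. (i) If $d'=d$: \[\begin{array}{c|c|c} \text{value}&\text{weight}&\text{multiplicity}\\ \hline 2^m & 2^{n-1}-2^{m-1} & \dfrac{2^{d-1}(2^m-1)(2^n+2^{m+1}+1)}{2^d+1}\\ -2^m & 2^{n-1}+2^{m-1} & \dfrac{2^{d-1}(2^m-1)(2^n-2^{n-d+1}+1)}{2^d-1}\\ -2^{m+d} & 2^{n-1}+2^{m+d-1} & \dfrac{(2^{m-d}-1)(2^n-1)}{2^{2d}-1}\\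 0 & 2^{n-1} & 2^{m-d}(2^n-1)\\ 2^n & 0 & 1 \end{array}\] (ii) If $d'=2d$: \[\begin{array}{c|c|c} \text{value}&\text{weight}&\text{multiplicity}\\ \hline -2^m & 2^{n-1}+2^{m-1} & \dfrac{2^{3d}(2^m-1)(2^n-2^{n-2d}-2^{n-3d}+2^m-2^{m-d}+1)}{(2^d+1)(2^{2d}-1)}\\ 2^{m+d} & 2^{n-1}-2^{m+d-1} & \dfrac{2^d(2^n-1)(2^m+2^{m-d}+2^{m-2d}+1)}{(2^d+1)^2}\\ -2^{m+2d} & 2^{n-1}+2^{m+2d-1} & \dfrac{(2^{m-d}-1)(2^n-1)}{(2^d+1)(2^{2d}-1)}\\ 2^n & 0 & 1 \end{array}\] -/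

import Mathlib

open Polynomial

namespace GenKasami

section ExponentialSum

variable {F : Type*} [Field F] [Fintype F] [Algebra (ZMod 2) F]
variable {K : IntermediateField (ZMod 2) F} {n m : ℕ}

/-- If `F` has `2 ^ n` elements with `n = 2 * m` and `K` is its subfield with `2 ^ m` elements,
then `x ^ (2 ^ m + 1)` lies in `K` for every `x` in `F`. -/
theorem pow_mem_subfield (hn : n = 2 * m) (hF : Fintype.card F = 2 ^ n)
    (hK : Nat.card K = 2 ^ m) (x : F) : x ^ (2 ^ m + 1) ∈ K := by
  classical
  have h := FiniteField.algebraMap_norm_eq_pow (K := K) (K' := F) (x := x)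
  have hm : m ≠ 0 := by
    rintro rfl
    have h1 := Finite.one_lt_card (α := K)
    rw [hK] at h1
    simp at h1
  have h2 : 1 < 2 ^ m := Nat.one_lt_two_pow hm
  have e : (2 ^ n - 1) / (2 ^ m - 1) = 2 ^ m + 1 := by
    apply Nat.div_eq_of_eq_mul_left (by omega)
    rw [hn, two_mul, pow_add]
    have := Nat.sq_sub_sq (2 ^ m) 1
    simpa [sq] using this
  rw [Nat.card_eq_fintype_card, hF, hK, e] at h
  rw [← h]
  exact (Algebra.norm K x).2

/-- The element `x ^ (2 ^ m + 1)`, regarded as an element of the subfield `K`. -/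
def powSub (hn : n = 2 * m) (hF : Fintype.card F = 2 ^ n) (hK : Nat.card K = 2 ^ m) (x : F) : K :=
  ⟨x ^ (2 ^ m + 1), pow_mem_subfield hn hF hK x⟩

/-- `Tr_1^m (α x^(2^m+1)) + Tr_1^n (β x^(2^k+1))`, an element of the prime field. -/
noncomputable def traceForm (hn : n = 2 * m) (hF : Fintype.card F = 2 ^ n)
    (hK : Nat.card K = 2 ^ m) (k : ℕ) (α : K) (β : F) (x : F) : ZMod 2 :=
  Algebra.trace (ZMod 2) K (α * powSub hn hF hK x) +
    Algebra.trace (ZMod 2) F (β * x ^ (2 ^ k + 1))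

/-- The exponential sum `T(α, β)`. -/
noncomputable def T (hn : n = 2 * m) (hF : Fintype.card F = 2 ^ n)
    (hK : Nat.card K = 2 ^ m) (k : ℕ) (α : K) (β : F) : ℤ :=
  ∑ x : F, (-1 : ℤ) ^ (traceForm hn hF hK k α β x).val

/-- The word `c(α, β)` of length `2 ^ n - 1`, with entries
`Tr_1^m (α π^(i(2^m+1))) + Tr_1^n (β π^(i(2^k+1)))`. -/
noncomputable def word (hn : n = 2 * m) (hF : Fintype.card F = 2 ^ n)
    (hK : Nat.card K = 2 ^ m) (k : ℕ) (π : Fˣ) (α : K) (β : F) : Fin (2 ^ n - 1) → ZMod 2 :=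
  fun i => traceForm hn hF hK k α β ((π : F) ^ (i : ℕ))

end ExponentialSum

section CyclicCode

/-- The polynomial `c_0 + c_1 X + ⋯ + c_{l-1} X^(l-1)` of a binary word of length `l`. -/
noncomputable def wordPoly {l : ℕ} (c : Fin l → ZMod 2) : (ZMod 2)[X] :=
  ∑ i, C (c i) * X ^ (i : ℕ)

/-- The binary cyclic code of length `l` with parity-check polynomial `h`
(a divisor of `X ^ l - 1`): the words `c` with `c(X) h(X) ≡ 0` modulo `X ^ l - 1`. -/
noncomputable def cyclicCode (l : ℕ) (h : (ZMod 2)[X]) : Submodule (ZMod 2) (Fin l → ZMod 2) where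
  carrier := {c | (X ^ l - 1 : (ZMod 2)[X]) ∣ wordPoly c * h}
  add_mem' := by
    intro a b ha hb
    have e : wordPoly (a + b) * h = wordPoly a * h + wordPoly b * h := by
      simp [wordPoly, add_mul, Finset.sum_add_distrib]
    simpa only [Set.mem_ofPred_eq, e] using dvd_add ha hb
  zero_mem' := by simp [wordPoly]
  smul_mem' := by
    intro r a ha
    have e : wordPoly (r • a) * h = C r * (wordPoly a * h) := by
      simp [wordPoly, Finset.mul_sum, Finset.sum_mul, mul_assoc]
    simpa only [Set.mem_ofPred_eq, e] using Dvd.dvd.mul_left ha (C r)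

variable {F : Type*} [Field F] [Algebra (ZMod 2) F]

/-- The parity-check polynomial `h₂ h₃`, where `h₂` and `h₃` are the minimal polynomials over
the prime field of `π^(-(2^k+1))` and `π^(-(2^m+1))`. -/
noncomputable def parityPoly (m k : ℕ) (π : Fˣ) : (ZMod 2)[X] :=
  minpoly (ZMod 2) ((π : F)⁻¹ ^ (2 ^ k + 1)) * minpoly (ZMod 2) ((π : F)⁻¹ ^ (2 ^ m + 1))

/-- The binary cyclic code `C₁` of length `2 ^ n - 1` with parity-check polynomial `h₂ h₃`. -/
noncomputable def codeC1 (n m k : ℕ) (π : Fˣ) : Submodule (ZMod 2) (Fin (2 ^ n - 1) → ZMod 2) :=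
  cyclicCode (2 ^ n - 1) (parityPoly m k π)

end CyclicCode

section Distribution

variable {F : Type*} [Field F] [Fintype F] [Algebra (ZMod 2) F]
variable {K : IntermediateField (ZMod 2) F} {n m : ℕ}

/-- `rows` (entries: value, weight, multiplicity) is the table of the value distribution of
`T(α, β)`, together with the weight of `c(α, β)`, and of the weight distribution of `C₁`. -/
def IsDistributionTable (hn : n = 2 * m) (hF : Fintype.card F = 2 ^ n)
    (hK : Nat.card K = 2 ^ m) (k : ℕ) (π : Fˣ) (rows : List (ℤ × ℕ × ℚ)) : Prop :=
  (∀ (α : K) (β : F), ∃ r ∈ rows,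
    T hn hF hK k α β = r.1 ∧ hammingNorm (word hn hF hK k π α β) = r.2.1) ∧
  (∀ r ∈ rows, (({p : K × F | T hn hF hK k p.1 p.2 = r.1}.ncard : ℕ) : ℚ) = r.2.2) ∧
  (∀ c ∈ codeC1 n m k π, ∃ r ∈ rows, hammingNorm c = r.2.1) ∧
  (∀ r ∈ rows, (({c | c ∈ codeC1 n m k π ∧ hammingNorm c = r.2.1}.ncard : ℕ) : ℚ) = r.2.2)

end Distribution

end GenKasami

/-! Write `c` for `x ↦ x^(2^m)` and `s` for `x ↦ x^(2^k)`, and choose `θ` with `θ + c θ = 1`. On `K`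
the trace is `Tr_1^m(a) = Tr_1^n(θ a)`, so `T(α, β)` is the exponential sum of the binary quadratic
form `Q(x) = Tr(θ α x c(x) + β x s(x))` on `F`. Its radical is the kernel of `φ(x) = α c(x) + β s(x)
+ s⁻¹(β x)`, and either `T = 0` or `T² = q |rad|`; a trivial radical excludes `T = 0`.

Order of the radical, for `(α, β) ≠ (0, 0)`. A maximal isotropic subspace over the field of `2^d`
elements is its own orthogonal, which makes `q |rad|` the square of a power of `2^d`
(`exists_card_ker_polarMap_mul`). A pairing on the radical with values in `Fix(s ∘ c)`, the field of
`2^d'` elements, gives `|rad| ≤ 2^(2d')` (`card_ker_polarMap_le`). Hence `|rad| = 2^(2dt)` with `dt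
≤ d'`.

Signs. If `d' = 2d`, then `Q` is invariant under the `(2^d+1)`-th roots of unity, so `T ≡ 1` modulo
`2^d + 1`; this excludes `0` and fixes every sign. If `d' = d` and the radical is nontrivial, it
contains some `x ≠ 0` with `β x s(x)` in `K`. The substitution `x y` turns `Q` into a Hermitian form
evaluated at `y + s(c(y))`, and Fourier inversion gives `T ≤ 0` (`expSum_nonpos`).

Multiplicities solve a linear system given by the number of pairs, `∑ T`, `∑ |rad|` and, if `d' =
d`, `∑ T²`. If `d' = 2d`, no sum vanishes and the first three suffice.

Code. Weight and sum are tied by `T = 2^n - 2 wt`. As `T = 2^n` only at `(0, 0)`, the encoding is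
injective; its words lie in `C₁`, and `|C₁| ≤ 2^(deg h₂h₃) ≤ 2^(n+m)` makes it onto. -/

namespace GenKasami

/-! ### Signs of prime-field elements and orthogonality -/

section Sign

/-- The sign `(-1) ^ a` of an element of the prime field. -/
def sgn (a : ZMod 2) : ℤ := (-1) ^ a.val

theorem sgn_zero : sgn 0 = 1 := rfl

theorem sgn_add : ∀ a b : ZMod 2, sgn (a + b) = sgn a * sgn b := by decide

theorem sgn_eq_ite : ∀ a : ZMod 2, sgn a = if a = 0 then 1 else -1 := by decide

theorem sgn_mul_self : ∀ a : ZMod 2, sgn a * sgn a = 1 := by decide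

/-- Orthogonality for a function that turns shifts into products of signs. -/
theorem sum_sgn_eq_zero_of_shift {G : Type*} [AddGroup G] [Fintype G] (f : G → ℤ) (g : G)
    (h : ∀ x, f (x + g) = -f x) : ∑ x, f x = 0 := by
  have h1 : ∑ x, f x = ∑ x, f (x + g) := (Equiv.sum_comp (Equiv.addRight g) f).symm
  simp only [h, Finset.sum_neg_distrib] at h1
  omega

theorem sum_sgn_addMonoidHom {G : Type*} [AddGroup G] [Fintype G] (f : G →+ ZMod 2) :
    (∑ x, sgn (f x) = Fintype.card G ∧ ∀ x, f x = 0) ∨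
      (∑ x, sgn (f x) = 0 ∧ ∃ x, f x ≠ 0) := by
  by_cases h : ∀ x, f x = 0
  · left
    simp [h, sgn_zero]
  · right
    push Not at h
    obtain ⟨g, hg⟩ := h
    refine ⟨sum_sgn_eq_zero_of_shift _ g fun x => ?_, g, hg⟩
    rw [map_add, sgn_add, sgn_eq_ite (f g), if_neg hg, mul_neg_one]

end Sign

/-! ### The quadratic form, its polarization and the square of its sum -/

section Quadratic

variable {F : Type*} [Field F] [Algebra (ZMod 2) F]

theorem two_eq_zero : (2 : F) = 0 := by
  have := map_ofNat (algebraMap (ZMod 2) F) 2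
  rw [← this, show (OfNat.ofNat 2 : ZMod 2) = 0 from rfl, map_zero]

theorem add_self_zero (x : F) : x + x = 0 := by
  linear_combination x * two_eq_zero (F := F)

theorem eq_of_add_eq_zero {x y : F} (h : x + y = 0) : x = y := by
  linear_combination h - y * two_eq_zero (F := F)

/-- The absolute trace. -/
noncomputable def tr (x : F) : ZMod 2 := Algebra.trace (ZMod 2) F x

theorem tr_add (x y : F) : tr (x + y) = tr x + tr y := map_add _ _ _

theorem tr_zero : tr (0 : F) = 0 := map_zero _

theorem tr_equiv (s : F ≃ₐ[ZMod 2] F) (x : F) : tr (s x) = tr x :=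
  Algebra.trace_eq_of_algEquiv s x

theorem eq_zero_of_tr_mul [Finite F] {x : F} (h : ∀ y, tr (y * x) = 0) : x = 0 := by
  have : FiniteDimensional (ZMod 2) F := Module.Finite.of_finite
  refine (traceForm_nondegenerate (ZMod 2) F).1 x fun y => ?_
  rw [Algebra.traceForm_apply, mul_comm]
  exact h y

theorem sum_sgn_tr_mul [Fintype F] [DecidableEq F] (x : F) :
    ∑ y : F, sgn (tr (y * x)) = if x = 0 then (Fintype.card F : ℤ) else 0 := by
  split_ifs with h
  · simp [h, sgn_zero, tr_zero]
  · have := sum_sgn_addMonoidHom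
      ((Algebra.trace (ZMod 2) F).toAddMonoidHom.comp (AddMonoidHom.mulRight x))
    rcases this with ⟨-, h2⟩ | ⟨h1, -⟩
    · exact absurd (eq_zero_of_tr_mul h2) h
    · exact h1

/-- The quadratic form `Tr(θ α x c(x)) + Tr(β x s(x))`. -/
noncomputable def quad (s c : F ≃ₐ[ZMod 2] F) (θ α β x : F) : ZMod 2 :=
  tr (θ * α * (x * c x) + β * (x * s x))

/-- The linearized map `α c(x) + β s(x) + s⁻¹(β x)` whose kernel is the radical of `quad`. -/
def polarMap (s c : F ≃ₐ[ZMod 2] F) (α β : F) : F →+ F where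
  toFun x := α * c x + β * s x + s.symm (β * x)
  map_zero' := by simp
  map_add' x y := by simp only [map_add, mul_add]; ring

theorem polarMap_apply (s c : F ≃ₐ[ZMod 2] F) (α β x : F) :
    polarMap s c α β x = α * c x + β * s x + s.symm (β * x) := rfl

/-- The exponential sum of `quad`. -/
noncomputable def expSum [Fintype F] (s c : F ≃ₐ[ZMod 2] F) (θ α β : F) : ℤ :=
  ∑ x : F, sgn (quad s c θ α β x)

variable {s c : F ≃ₐ[ZMod 2] F} {θ α β : F}

theorem quad_zero : quad s c θ α β 0 = 0 := by simp [quad, tr_zero]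

/-- The trace is invariant under `c`, so the coefficient `θ` of `c z` becomes the coefficient `c θ`
of `z`, and `θ + c θ = 1`. This is how `θ` disappears from the polar form. -/
theorem tr_mul_conj (hc : ∀ x, c (c x) = x) (hθ : θ + c θ = 1) (hα : c α = α) (z : F) :
    tr (θ * α * (z + c z)) = tr (α * z) := by
  have h : tr (θ * α * c z) = tr (c θ * α * z) := by
    rw [← tr_equiv c]
    simp only [map_mul, hc, hα]
  rw [mul_add, tr_add, h, ← tr_add]
  congr 1
  linear_combination α * z * hθ

theorem quad_add (hc : ∀ x, c (c x) = x) (hθ : θ + c θ = 1) (hα : c α = α) (x y : F) :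
    quad s c θ α β (x + y) =
      quad s c θ α β x + quad s c θ α β y + tr (y * polarMap s c α β x) := by
  have h1 : tr (θ * α * (y * c x + c (y * c x))) = tr (α * (y * c x)) :=
    tr_mul_conj hc hθ hα _
  have h2 : tr (y * s.symm (β * x)) = tr (β * (x * s y)) := by
    rw [← tr_equiv s]
    simp only [map_mul, AlgEquiv.apply_symm_apply]
    congr 1
    ring
  have h3 : tr (y * polarMap s c α β x) =
      tr (θ * α * (y * c x + c (y * c x))) + tr (β * (y * s x)) + tr (β * (x * s y)) := by
    rw [h1, ← h2, ← tr_add, ← tr_add, polarMap_apply]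
    congr 1
    ring
  rw [h3]
  simp only [quad]
  simp only [← tr_add]
  congr 1
  simp only [map_add, map_mul, hc]
  ring

theorem tr_polarMap_symm (hc : ∀ x, c (c x) = x) (hα : c α = α) (x y : F) :
    tr (y * polarMap s c α β x) = tr (x * polarMap s c α β y) := by
  have h1 : tr (y * (α * c x)) = tr (x * (α * c y)) := by
    rw [← tr_equiv c]
    simp only [map_mul, hc, hα]
    congr 1
    ring
  have h2 : ∀ x y : F, tr (y * s.symm (β * x)) = tr (x * (β * s y)) := by
    intro x y
    rw [← tr_equiv s]
    simp only [map_mul, AlgEquiv.apply_symm_apply]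
    congr 1
    ring
  simp only [polarMap_apply, mul_add, tr_add, h1, h2]
  rw [add_right_comm]

theorem tr_self_polarMap (hc : ∀ x, c (c x) = x) (hθ : θ + c θ = 1) (hα : c α = α) (x : F) :
    tr (x * polarMap s c α β x) = 0 := by
  have h := quad_add (s := s) (β := β) hc hθ hα x x
  rw [add_self_zero, quad_zero] at h
  generalize quad s c θ α β x = a at h
  generalize tr (x * polarMap s c α β x) = b at h ⊢
  revert a b; decide

/-- Substituting `x + y` for the second variable of the double sum and polarizing leaves the
character `x ↦ Tr(x φ(y))`, whose sum over `x` vanishes unless `y` is in the radical. -/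
theorem expSum_sq [Fintype F] [DecidableEq F] (hc : ∀ x, c (c x) = x) (hθ : θ + c θ = 1)
    (hα : c α = α) :
    expSum s c θ α β ^ 2 =
      Fintype.card F * ∑ y : (polarMap s c α β).ker, sgn (quad s c θ α β y) := by
  have h : expSum s c θ α β ^ 2 =
      ∑ y : F, sgn (quad s c θ α β y) * (if polarMap s c α β y = 0 then (Fintype.card F : ℤ) else 0) := by
    calc expSum s c θ α β ^ 2
        = ∑ x : F, ∑ y : F, sgn (quad s c θ α β x) * sgn (quad s c θ α β y) := by
          rw [sq, expSum, Finset.sum_mul_sum]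
      _ = ∑ x : F, ∑ y : F, sgn (quad s c θ α β x) * sgn (quad s c θ α β (x + y)) := by
          refine Finset.sum_congr rfl fun x _ => ?_
          exact (Equiv.sum_comp (Equiv.addLeft x)
            fun y => sgn (quad s c θ α β x) * sgn (quad s c θ α β y)).symm
      _ = ∑ x : F, ∑ y : F, sgn (quad s c θ α β y) * sgn (tr (x * polarMap s c α β y)) := by
          refine Finset.sum_congr rfl fun x _ => Finset.sum_congr rfl fun y _ => ?_
          rw [quad_add hc hθ hα, sgn_add, sgn_add, tr_polarMap_symm hc hα, ← mul_assoc,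
            ← mul_assoc, sgn_mul_self, one_mul]
      _ = _ := by
          rw [Finset.sum_comm]
          refine Finset.sum_congr rfl fun y _ => ?_
          rw [← Finset.mul_sum, sum_sgn_tr_mul]
  rw [h, Finset.mul_sum]
  simp only [mul_ite, mul_zero, ← Finset.sum_filter]
  rw [← Finset.sum_subtype (p := fun y => y ∈ (polarMap s c α β).ker)
    (Finset.univ.filter fun y => polarMap s c α β y = 0)
    (by intro x; simp [AddMonoidHom.mem_ker])
    (fun y => (Fintype.card F : ℤ) * sgn (quad s c θ α β y))]
  exact Finset.sum_congr rfl fun y _ => mul_comm _ _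

/-- On its radical the form is additive, so the remaining sum is either zero or the order of the
radical. -/
theorem expSum_sq_eq [Fintype F] (hc : ∀ x, c (c x) = x) (hθ : θ + c θ = 1)
    (hα : c α = α) :
    expSum s c θ α β = 0 ∨
      expSum s c θ α β ^ 2 = Fintype.card F * Nat.card (polarMap s c α β).ker := by
  classical
  rw [expSum_sq hc hθ hα]
  let f : (polarMap s c α β).ker →+ ZMod 2 :=
    { toFun := fun y => quad s c θ α β y
      map_zero' := quad_zero
      map_add' := by
        rintro ⟨x, hx⟩ ⟨y, hy⟩
        rw [AddMonoidHom.mem_ker] at hx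
        simp [quad_add hc hθ hα, hx, tr_zero] }
  rcases sum_sgn_addMonoidHom f with ⟨h, -⟩ | ⟨h, -⟩
  · right
    rw [Nat.card_eq_fintype_card, ← h]
    rfl
  · left
    rw [← sq_eq_zero_iff, expSum_sq hc hθ hα]
    rw [show ∑ y : (polarMap s c α β).ker, sgn (quad s c θ α β y) = 0 from h, mul_zero]

theorem expSum_sq_of_ker_card_eq_one [Fintype F] (hc : ∀ x, c (c x) = x) (hθ : θ + c θ = 1)
    (hα : c α = α) (h : Nat.card (polarMap s c α β).ker = 1) :
    expSum s c θ α β ^ 2 = Fintype.card F := by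
  classical
  rw [expSum_sq hc hθ hα]
  have : Unique (polarMap s c α β).ker := by
    have := Nat.card_eq_one_iff_unique.mp h
    exact ⟨⟨0⟩, fun a => this.1.elim _ _⟩
  rw [Fintype.sum_unique]
  have e : ((default : (polarMap s c α β).ker) : F) = 0 := by
    rw [Unique.eq_default (0 : (polarMap s c α β).ker) |>.symm]; rfl
  rw [e, quad_zero, sgn_zero, mul_one]

end Quadratic

/-! ### The order of the radical -/

section Radical

variable {F : Type*} [Field F] [Algebra (ZMod 2) F] {s c : F ≃ₐ[ZMod 2] F} {θ α β : F}

/-- Apply `s` to the radical equation of `x` and `c ∘ s` to that of `y`; multiplied by `s y` and `c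
(s x)` respectively, their terms in `s α` agree and cancel in characteristic two. -/
theorem pairing_semilinear_fixed (hc : ∀ x, c (c x) = x) (hsc : ∀ x, s (c x) = c (s x))
    (hα : c α = α) {x y : F} (hx : polarMap s c α β x = 0) (hy : polarMap s c α β y = 0) :
    s (c (β * s y * x + c (β * s x * y))) = β * s y * x + c (β * s x * y) := by
  have h1 := congrArg (fun t => c (s (c t))) hx
  have h2 := congrArg (fun t => c (s t)) hy
  simp only [polarMap_apply, map_add, map_mul, map_zero, hsc, hc, hα,
    AlgEquiv.apply_symm_apply] at h1 h2
  simp only [map_add, map_mul, hsc, hc]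
  linear_combination s y * h1 + c (s x) * h2
    - (c (s α) * s y * c (s x) + β * x * s y + c β * c (s x) * c y) * two_eq_zero (F := F)

/-- Pairing with a fixed nonzero radical vector `x` is an additive map from the radical to `Fix(s ∘
c)`. Any two elements of its kernel have their ratio in `Fix(s ∘ c)`, so both range and kernel have
at most that order. -/
theorem card_ker_polarMap_le [Finite F] (hc : ∀ x, c (c x) = x) (hsc : ∀ x, s (c x) = c (s x))
    (hα : c α = α) (hβ : β ≠ 0) :
    Nat.card (polarMap s c α β).ker ≤ Nat.card {e : F // s (c e) = e} ^ 2 := by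
  have hD : 0 < Nat.card {e : F // s (c e) = e} :=
    have : Nonempty {e : F // s (c e) = e} := ⟨0, by simp⟩
    Nat.card_pos
  by_cases hx : ∃ x ∈ (polarMap s c α β).ker, x ≠ 0
  · obtain ⟨x, hx, hx0⟩ := hx
    let p : F →+ F :=
      { toFun := fun y => β * s y * x + c (β * s x * y)
        map_zero' := by simp
        map_add' := fun a b => by simp only [map_add, mul_add]; ring }
    let q : (polarMap s c α β).ker →+ F := p.comp (polarMap s c α β).ker.subtype
    have hrange : Nat.card q.range ≤ Nat.card {e : F // s (c e) = e} := by
      apply Nat.card_le_card_of_injective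
        (fun z : q.range => (⟨z.1, by
          obtain ⟨_, ⟨y, hy⟩, rfl⟩ := z
          exact pairing_semilinear_fixed hc hsc hα hx hy⟩ : {e : F // s (c e) = e}))
      intro a b hab
      exact Subtype.ext (congrArg (fun z : {e : F // s (c e) = e} => z.1) hab)
    have hker : Nat.card q.ker ≤ Nat.card {e : F // s (c e) = e} := by
      by_cases hy : ∃ y : F, y ≠ 0 ∧ p y = 0
      · obtain ⟨y, hy0, hy⟩ := hy
        have key : ∀ z : F, p z = 0 → s (c (z / y)) = z / y := by
          intro z hz
          have h1 : β * s y * x = c (β * s x * y) := eq_of_add_eq_zero hy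
          have h2 : β * s z * x = c (β * s x * z) := eq_of_add_eq_zero hz
          have h3 : s (z / y) = c (z / y) := by
            rw [map_div₀, map_div₀, div_eq_div_iff (by simpa using hy0) (by simpa using hy0)]
            rw [map_mul] at h1 h2
            have h4 : β * x ≠ 0 := mul_ne_zero hβ hx0
            apply mul_left_cancel₀ h4
            have h5 : c (β * s x) ≠ 0 := by simpa using ⟨hβ, hx0⟩
            linear_combination c y * h2 - c z * h1
          rw [hsc, h3, hc]
        apply Nat.card_le_card_of_injective
          (fun z : q.ker => (⟨(z.1 : F) / y, key _ z.2⟩ : {e : F // s (c e) = e}))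
        intro a b hab
        have := congrArg Subtype.val hab
        exact Subtype.ext (Subtype.ext ((div_left_inj' hy0).mp this))
      · have : Subsingleton q.ker := by
          refine ⟨fun a b => Subtype.ext (Subtype.ext ?_)⟩
          have h : ∀ a : q.ker, (a.1 : F) = 0 := fun a => by
            by_contra h
            exact hy ⟨_, h, a.2⟩
          rw [h a, h b]
        exact Finite.card_le_one_iff_subsingleton.mpr this |>.trans hD
    have h := AddSubgroup.card_mul_index q.ker
    rw [AddSubgroup.index_ker] at h
    rw [← h, sq]
    exact Nat.mul_le_mul hker hrange
  · have : Subsingleton (polarMap s c α β).ker := by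
      refine ⟨fun a b => Subtype.ext ?_⟩
      have h : ∀ a : (polarMap s c α β).ker, (a : F) = 0 := fun a => by
        by_contra h
        exact hx ⟨_, a.2, h⟩
      rw [h a, h b]
    exact (Finite.card_le_one_iff_subsingleton.mpr this).trans (Nat.one_le_pow _ _ hD)

theorem polarMap_smul {e : F} (hs : s e = e) (hce : c e = e) (x : F) :
    polarMap s c α β (e * x) = e * polarMap s c α β x := by
  have h : s.symm e = e := by rw [AlgEquiv.symm_apply_eq, hs]
  simp only [polarMap_apply, map_mul, hs, hce, h]
  ring

/-- The order of the radical times `|F|` is the square of the order of a maximal totally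
isotropic subspace. -/
theorem exists_card_ker_polarMap_mul [Fintype F] (hc : ∀ x, c (c x) = x) (hθ : θ + c θ = 1)
    (hα : c α = α) (L : Subfield F) (hL : ∀ e ∈ L, s e = e ∧ c e = e) :
    ∃ j : ℕ, Fintype.card F * Nat.card (polarMap s c α β).ker = (Nat.card L ^ j) ^ 2 := by
  classical
  set φ := polarMap s c α β with hφ
  -- `W` is maximal among the `L`-subspaces isotropic for `Tr(y φ(x))`. It equals its orthogonal,
  -- since any orthogonal vector could be adjoined to it.
  obtain ⟨W, hW⟩ := (Set.toFinite {W : Submodule L F | ∀ x ∈ W, ∀ y ∈ W, tr (y * φ x) = 0}).exists_maximal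
    ⟨⊥, by
      intro x hx y hy
      simp only [Submodule.mem_bot] at hx
      simp [hx, tr_zero]⟩
  have hiso : ∀ x ∈ W, ∀ y ∈ W, tr (y * φ x) = 0 := hW.1
  have hsymm : ∀ x y, tr (y * φ x) = tr (x * φ y) := tr_polarMap_symm hc hα
  have hsm : ∀ (e : L) (x : F), φ (e • x) = e • φ x := fun e x => by
    rw [Subfield.smul_def, Subfield.smul_def, smul_eq_mul, smul_eq_mul]
    exact polarMap_smul (hL e e.2).1 (hL e e.2).2 x
  have hperp : ∀ y, (∀ x ∈ W, tr (y * φ x) = 0) → y ∈ W := by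
    intro y hy
    have h2 : W ⊔ Submodule.span L {y} ∈
        {W : Submodule L F | ∀ x ∈ W, ∀ y ∈ W, tr (y * φ x) = 0} := by
      intro u hu v hv
      obtain ⟨w, hw, z, hz, rfl⟩ := Submodule.mem_sup.mp hu
      obtain ⟨w', hw', z', hz', rfl⟩ := Submodule.mem_sup.mp hv
      obtain ⟨e, rfl⟩ := Submodule.mem_span_singleton.mp hz
      obtain ⟨e', rfl⟩ := Submodule.mem_span_singleton.mp hz'
      have a1 := hiso w hw w' hw'
      have a2 : tr (w' * φ (e • y)) = 0 := by
        rw [hsm, mul_smul_comm, ← smul_mul_assoc, hsymm]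
        exact hy _ (W.smul_mem e hw')
      have a3 : tr (e' • y * φ w) = 0 := by
        rw [smul_mul_assoc, ← mul_smul_comm, ← hsm]
        exact hy _ (W.smul_mem e' hw)
      have a4 : tr (e' • y * φ (e • y)) = 0 := by
        have : CharP L 2 := by
          have : CharP F 2 := charP_of_injective_algebraMap (algebraMap (ZMod 2) F).injective 2
          exact (RingHom.charP_iff L.subtype L.subtype.injective 2).mpr this
        -- Every element of `L` is a square, so `e' e = b²` reduces the trace to `Tr(b y φ(b y))`,
        -- which vanishes as the polar form is alternating.
        obtain ⟨b, hb⟩ := FiniteField.isSquare_of_char_two (ringChar.eq_iff.mpr this) (e' * e)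
        rw [hsm, mul_smul_comm, smul_mul_assoc, smul_smul, mul_comm e, hb, ← smul_smul,
          ← smul_mul_assoc, ← mul_smul_comm, ← hsm]
        exact tr_self_polarMap hc hθ hα _
      rw [map_add, add_mul, mul_add, mul_add, tr_add, tr_add, tr_add, a1, a2, a3, a4]
      simp
    exact hW.2 h2 le_sup_left (Submodule.mem_sup_right (Submodule.mem_span_singleton_self y))
  have hrad : ∀ x, φ x = 0 → x ∈ W := fun x hx => hperp x fun w _ => by
    rw [hsymm, hx, mul_zero, tr_zero]
  -- The double sum over `W × F` is evaluated in both orders: summing over `F` first leaves the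
  -- radical, summing over `W` first leaves the orthogonal of `W`, which is `W`.
  have c1 : ∑ x : W, ∑ y : F, sgn (tr (y * φ x)) = Fintype.card F * Nat.card φ.ker := by
    simp only [sum_sgn_tr_mul]
    rw [← Finset.sum_filter, Finset.sum_const, nsmul_eq_mul, mul_comm]
    congr 2
    rw [← Fintype.card_subtype, ← Nat.card_eq_fintype_card]
    refine Nat.card_congr ⟨fun x => ⟨x.1, x.2⟩, fun x => ⟨⟨x.1, hrad _ x.2⟩, x.2⟩, ?_, ?_⟩
    · intro x; rfl
    · intro x; rfl
  have c2 : ∑ y : F, ∑ x : W, sgn (tr (y * φ x)) = (Nat.card W : ℤ) ^ 2 := by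
    have : ∀ y : F, ∑ x : W, sgn (tr (y * φ x)) = if y ∈ W then (Nat.card W : ℤ) else 0 := by
      intro y
      let f : W →+ ZMod 2 :=
        { toFun := fun x => tr (y * φ x)
          map_zero' := by simp [tr_zero]
          map_add' := fun a b => by simp [mul_add, tr_add] }
      rcases sum_sgn_addMonoidHom f with ⟨h1, h2⟩ | ⟨h1, x, h2⟩
      · rw [if_pos (hperp y fun x hx => h2 ⟨x, hx⟩), Nat.card_eq_fintype_card]
        exact h1
      · rw [if_neg fun hy => h2 (hiso x x.2 y hy)]
        exact h1
    simp only [this]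
    rw [← Finset.sum_filter, Finset.sum_const, nsmul_eq_mul, sq]
    congr 2
    rw [← Fintype.card_subtype, ← Nat.card_eq_fintype_card]
  refine ⟨Module.finrank L W, ?_⟩
  rw [← Module.natCard_eq_pow_finrank (K := L) (V := W)]
  rw [Finset.sum_comm, c2] at c1
  exact_mod_cast c1.symm

end Radical

/-! ### Sums invariant under roots of unity -/

section Congruence

/-- A sum over a finite field of a function invariant under the `r`-th roots of unity is
congruent modulo `r` to the value at zero, if `r` divides `|F| - 1`. -/
theorem dvd_sum_sub_of_invariant {F : Type*} [Field F] [Fintype F] (f : F → ℤ) (r : ℕ)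
    (hr : r ∣ Fintype.card F - 1) (hf : ∀ t x : F, t ^ r = 1 → f (t * x) = f x) :
    (r : ℤ) ∣ ∑ x, f x - f 0 := by
  classical
  have h1 : ∑ x, f x = f 0 + ∑ u : Fˣ, f u := by
    rw [← Finset.add_sum_erase _ _ (Finset.mem_univ 0)]
    congr 1
    rw [Finset.sum_subtype (p := fun x : F => x ≠ 0) _ (by simp)]
    exact (Equiv.sum_comp unitsEquivNeZero (fun x : {x : F // x ≠ 0} => f x)).symm
  rw [h1, add_sub_cancel_left,
    ← Finset.sum_fiberwise (s := Finset.univ) (g := fun u : Fˣ => powMonoidHom r u)]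
  refine Finset.dvd_sum fun y _ => ?_
  by_cases hy : ∃ u : Fˣ, powMonoidHom r u = y
  · obtain ⟨u, rfl⟩ := hy
    have h2 : ∀ v ∈ Finset.univ.filter (fun v : Fˣ => powMonoidHom r v = powMonoidHom r u),
        f v = f u := by
      intro v hv
      rw [Finset.mem_filter] at hv
      have := hf (v * u⁻¹ : Fˣ) u (by
        have h3 := hv.2
        simp only [powMonoidHom_apply] at h3
        rw [← Units.val_pow_eq_pow_val, mul_pow, h3, ← mul_pow, mul_inv_cancel, one_pow,
          Units.val_one])
      rw [← this, ← Units.val_mul, inv_mul_cancel_right]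
    rw [Finset.sum_congr rfl h2, Finset.sum_const, nsmul_eq_mul]
    apply Dvd.dvd.mul_right
    -- Nonempty fibres of `u ↦ u ^ r` are cosets of the group of `r`-th roots of unity, which has
    -- exactly `r` elements because `r` divides the order of the cyclic group `Fˣ`.
    have h4 : (Finset.univ.filter (fun v : Fˣ => powMonoidHom r v = powMonoidHom r u)).card
        = r := by
      rw [MonoidHom.card_fiber_eq_of_mem_range (powMonoidHom r) ⟨u, rfl⟩ ⟨1, map_one _⟩]
      have h5 := IsCyclic.card_powMonoidHom_ker (G := Fˣ) r
      rw [Nat.card_eq_fintype_card, Nat.card_eq_fintype_card, Fintype.card_units,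
        Nat.gcd_eq_right hr] at h5
      rw [← Fintype.card_subtype]
      convert h5
      exact MonoidHom.mem_ker.symm
    rw [h4]
  · rw [Finset.sum_eq_zero]
    · exact dvd_zero _
    · intro v hv
      rw [Finset.mem_filter] at hv
      exact absurd ⟨v, hv.2⟩ hy

end Congruence

/-! ### Hermitian forms and the sign of the sum -/

section SignOfSum

variable {F : Type*} [Field F] [Algebra (ZMod 2) F] {s c : F ≃ₐ[ZMod 2] F} {θ α β γ : F}

theorem tr_eq_zero_of_conj_eq (hc : ∀ x, c (c x) = x) (hθ : θ + c θ = 1) {x : F}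
    (hx : c x = x) : tr x = 0 := by
  have h := tr_mul_conj hc hθ (map_one c) x
  rw [hx, add_self_zero, mul_zero, tr_zero, one_mul] at h
  exact h.symm

theorem card_ker_polarMap_zero_right (hγ0 : γ ≠ 0) :
    Nat.card (polarMap s c γ 0).ker = 1 := by
  rw [AddSubgroup.card_eq_one, eq_bot_iff]
  intro x hx
  simpa [AddMonoidHom.mem_ker, polarMap_apply, hγ0] using hx

/-- The radical is trivial, so the sum is `±N`. The Hermitian form is invariant under elements of
norm one, so the sum is `1` modulo `N + 1`, which rules out `+N`. -/
theorem expSum_zero_right [Fintype F] {N : ℕ} (hN : 2 ≤ N) (hF : Fintype.card F = N ^ 2)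
    (hcN : ∀ x, c x = x ^ N) (hc : ∀ x, c (c x) = x) (hθ : θ + c θ = 1) (hγ : c γ = γ)
    (hγ0 : γ ≠ 0) : expSum s c θ γ 0 = -N := by
  have hsq := expSum_sq_of_ker_card_eq_one (s := s) hc hθ hγ (card_ker_polarMap_zero_right hγ0)
  rw [hF, Nat.cast_pow, sq_eq_sq_iff_eq_or_eq_neg] at hsq
  refine hsq.resolve_left fun h => ?_
  have hdvd := dvd_sum_sub_of_invariant (fun x => sgn (quad s c θ γ 0 x)) (N + 1)
    (by rw [hF]; exact ⟨N - 1, by simpa using Nat.sq_sub_sq N 1⟩) (by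
      intro t x ht
      have : t * c t = 1 := by rw [hcN, ← pow_succ', ht]
      simp only [quad]
      congr 2
      rw [map_mul]
      linear_combination θ * γ * x * c x * this)
  rw [quad_zero, sgn_zero] at hdvd
  change _ ∣ expSum s c θ γ 0 - 1 at hdvd
  rw [h] at hdvd
  have := Int.le_of_dvd (by omega) hdvd
  push_cast at this
  omega

/-- With `γ = β x s(x)`, the radical equation says `α x c(x) = γ + s⁻¹ γ`. The resulting terms match
the expansion of `γ w c(w)` at `w = y + s(c(y))`, up to elements of trace zero. -/
theorem quad_mul_of_mem_ker (hc : ∀ x, c (c x) = x) (hsc : ∀ x, s (c x) = c (s x))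
    (hθ : θ + c θ = 1) {x : F} (hx : polarMap s c α β x = 0)
    (hγ : c (β * x * s x) = β * x * s x) (y : F) :
    quad s c θ α β (x * y) = quad s c θ (β * x * s x) 0 (y + s (c y)) := by
  set γ := β * x * s x with hγdef
  have h1 : α * (x * c x) = γ + s.symm γ := by
    have h2 : s.symm γ = x * s.symm (β * x) := by
      rw [hγdef, map_mul, AlgEquiv.symm_apply_apply, mul_comm]
    rw [h2, hγdef]
    rw [polarMap_apply] at hx
    linear_combination x * hx - (β * x * s x + x * s.symm (β * x)) * two_eq_zero (F := F)
  have h3 : tr (θ * (s.symm γ * (y * c y))) = tr (θ * γ * (s y * s (c y))) := by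
    rw [← tr_equiv s]
    simp only [map_mul, AlgEquiv.apply_symm_apply]
    -- Moving `s` across the trace replaces `θ` by `s θ`; the difference `s θ + θ` is fixed by `c`,
    -- so it contributes the trace of a `c`-fixed element, which is zero.
    have h4 : c ((s θ + θ) * γ * (s y * s (c y))) = (s θ + θ) * γ * (s y * s (c y)) := by
      simp only [map_mul, map_add, hγ, hsc, hc]
      have h5 : c θ = 1 + θ := by linear_combination hθ - θ * two_eq_zero (F := F)
      have h6 : c (s θ) = 1 + s θ := by rw [← hsc, h5, map_add, map_one]
      rw [h5, h6]
      linear_combination γ * (s y * c (s y)) * two_eq_zero (F := F)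
    have h7 := tr_eq_zero_of_conj_eq hc hθ h4
    rw [add_mul, add_mul, tr_add] at h7
    have : ∀ a b : ZMod 2, a + b = 0 → a = b := by decide
    rw [← this _ _ h7]
    congr 1
    ring
  have h8 : tr (β * (x * y * s (x * y))) = tr (θ * γ * (y * s y + c y * c (s y))) := by
    rw [← map_mul c, tr_mul_conj hc hθ hγ]
    congr 1
    rw [map_mul, hγdef]
    ring
  have h9 : θ * α * (x * y * c (x * y)) =
      θ * (s.symm γ * (y * c y)) + θ * γ * (y * c y) := by
    rw [map_mul]
    linear_combination θ * y * c y * h1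
  simp only [quad]
  rw [tr_add, h8, h9, tr_add, h3, ← tr_add, ← tr_add]
  congr 1
  simp only [map_add, hsc, hc]
  ring

/-- Fourier inversion writes the sum as `-N` times the sum of an additive character over `χ.ker`,
and a character sum over a finite group is nonnegative. -/
theorem expSum_nonpos [Fintype F] {N : ℕ} (hN : 2 ≤ N) (hF : Fintype.card F = N ^ 2)
    (hcN : ∀ x, c x = x ^ N) (hc : ∀ x, c (c x) = x) (hsc : ∀ x, s (c x) = c (s x))
    (hθ : θ + c θ = 1) (hD : ∀ e, s (c e) = e → c e = e)
    {x : F} (hx0 : x ≠ 0) (hβ : β ≠ 0) (hx : polarMap s c α β x = 0)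
    (hγ : c (β * x * s x) = β * x * s x) : expSum s c θ α β ≤ 0 := by
  classical
  set γ := β * x * s x with hγdef
  have hγ0 : γ ≠ 0 := mul_ne_zero (mul_ne_zero hβ hx0) (by simpa using hx0)
  have hT : expSum s c θ α β = ∑ y : F, sgn (quad s c θ γ 0 (y + s (c y))) := by
    rw [expSum, ← Equiv.sum_comp (Equiv.mulLeft₀ x hx0)]
    refine Finset.sum_congr rfl fun y _ => ?_
    change sgn (quad s c θ α β (x * y)) = _
    rw [quad_mul_of_mem_ker hc hsc hθ hx hγ]
  -- `χ` is the trace adjoint of `y ↦ y + s(c(y))`; its kernel is exactly the set of frequencies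
  -- that survive the summation over `y`.
  let χ : F →+ F :=
    { toFun := fun e => e + c (s.symm e)
      map_zero' := by simp
      map_add' := fun a b => by simp only [map_add]; ring }
  have hχ : ∀ e, χ e = 0 → c e = e := by
    intro e he
    have h1 : e = c (s.symm e) := eq_of_add_eq_zero he
    apply hD
    rw [hsc]
    conv_lhs => rw [h1]
    rw [hsc, hc, AlgEquiv.apply_symm_apply]
  -- Completing the square: the shift by `e / γ` absorbs the linear character `Tr(e z)`, at the
  -- price of the sign of the form at `e / γ`.
  have hH : ∀ e, χ e = 0 → ∑ z : F, sgn (quad s c θ γ 0 z) * sgn (tr (e * z)) =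
      -N * sgn (quad s c θ γ 0 (e / γ)) := by
    intro e he
    have hce := hχ e he
    rw [← expSum_zero_right (s := s) hN hF hcN hc hθ hγ hγ0, expSum,
      ← Equiv.sum_comp (Equiv.addRight (e / γ)) (fun z => sgn (quad s c θ γ 0 z)), Finset.sum_mul]
    refine Finset.sum_congr rfl fun z _ => ?_
    have h2 : tr (e / γ * polarMap s c γ 0 z) = tr (e * z) := by
      rw [← tr_equiv c]
      congr 1
      simp only [polarMap_apply, zero_mul, map_zero, add_zero, map_mul, map_div₀, hce, hγ, hc]
      field_simp
    rw [Equiv.coe_addRight, quad_add hc hθ hγ, h2, sgn_add, sgn_add]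
    linear_combination (-sgn (quad s c θ γ 0 z) * sgn (tr (e * z))) *
      sgn_mul_self (quad s c θ γ 0 (e / γ))
  have hexp : (Fintype.card F : ℤ) * expSum s c θ α β =
      Fintype.card F * ∑ e : χ.ker, -N * sgn (quad s c θ γ 0 (e / γ)) := by
    calc (Fintype.card F : ℤ) * expSum s c θ α β
        = ∑ y : F, ∑ z : F, sgn (quad s c θ γ 0 z) *
            ∑ e : F, sgn (tr (e * (z + (y + s (c y))))) := by
          rw [hT, Finset.mul_sum]
          refine Finset.sum_congr rfl fun y _ => ?_
          simp only [sum_sgn_tr_mul]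
          rw [Finset.sum_eq_single (y + s (c y))]
          · rw [if_pos (add_self_zero _), mul_comm]
          · intro z _ hz
            rw [if_neg fun h => hz (eq_of_add_eq_zero h), mul_zero]
          · simp
      _ = ∑ e : F, (∑ z : F, sgn (quad s c θ γ 0 z) * sgn (tr (e * z))) *
            ∑ y : F, sgn (tr (y * χ e)) := by
          simp only [Finset.mul_sum]
          refine Eq.trans Finset.sum_comm_cycle ?_
          refine Finset.sum_congr rfl fun e _ => ?_
          rw [← Finset.mul_sum, Finset.sum_mul_sum, Finset.sum_comm]
          refine Finset.sum_congr rfl fun z _ => Finset.sum_congr rfl fun y _ => ?_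
          have h3 : tr (e * (y + s (c y))) = tr (y * χ e) := by
            have h4 : tr (e * s (c y)) = tr (y * c (s.symm e)) := by
              rw [← tr_equiv s.symm, ← tr_equiv c]
              simp only [map_mul, AlgEquiv.symm_apply_apply, hc]
              rw [mul_comm]
            change _ = tr (y * (e + c (s.symm e)))
            rw [mul_add, mul_add, tr_add, tr_add, h4, mul_comm]
          rw [mul_add, tr_add, sgn_add, h3, mul_assoc]
      _ = _ := by
          simp only [sum_sgn_tr_mul, mul_ite, mul_zero, ← Finset.sum_filter]
          rw [Finset.mul_sum, ← Finset.sum_subtype (p := fun e => e ∈ χ.ker)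
            (Finset.univ.filter fun e => χ e = 0)
            (by intro x; simp [AddMonoidHom.mem_ker])
            (fun e => (Fintype.card F : ℤ) * (-N * sgn (quad s c θ γ 0 (e / γ))))]
          refine Finset.sum_congr rfl fun e he => ?_
          rw [hH e (Finset.mem_filter.mp he).2, mul_comm]
  have hcard : (Fintype.card F : ℤ) ≠ 0 := by exact_mod_cast Fintype.card_ne_zero
  rw [mul_left_cancel₀ hcard hexp, ← Finset.mul_sum]
  let f : χ.ker →+ ZMod 2 :=
    { toFun := fun e => quad s c θ γ 0 (e / γ)
      map_zero' := by simp [quad_zero]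
      map_add' := by
        rintro ⟨a, ha⟩ ⟨b, hb⟩
        have h5 : tr (b / γ * polarMap s c γ 0 (a / γ)) = 0 := by
          apply tr_eq_zero_of_conj_eq hc hθ
          simp only [polarMap_apply, zero_mul, map_zero, add_zero, map_mul, map_div₀, hγ,
            hχ a ha, hχ b hb]
        simp [add_div, quad_add hc hθ hγ, h5] }
  have hnn : 0 ≤ ∑ e, sgn (f e) := by
    rcases sum_sgn_addMonoidHom f with ⟨h, -⟩ | ⟨h, -⟩ <;> rw [h]
    positivity
  have : (0 : ℤ) ≤ N := by positivity
  change -(N : ℤ) * ∑ e, sgn (f e) ≤ 0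
  nlinarith

end SignOfSum

/-! ### Moments of the sum and of the radical order -/

section Moments

variable {F : Type*} [Field F] [Algebra (ZMod 2) F] {s c : F ≃ₐ[ZMod 2] F} {θ : F}
variable {K : IntermediateField (ZMod 2) F}

theorem sum_sgn_tr_pair [Fintype F] [Fintype K] [DecidableEq F] (hc : ∀ x, c (c x) = x)
    (hθ : θ + c θ = 1) (hK : ∀ x, x ∈ K ↔ c x = x) {a b : F} (ha : c a = a) :
    ∑ α : K, ∑ β : F, sgn (tr (θ * α * a + β * b)) =
      if a = 0 ∧ b = 0 then (Fintype.card K * Fintype.card F : ℤ) else 0 := by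
  simp only [tr_add, sgn_add, ← Finset.mul_sum, ← Finset.sum_mul, sum_sgn_tr_mul]
  have h1 : ∑ α : K, sgn (tr (θ * α * a)) = if a = 0 then (Fintype.card K : ℤ) else 0 := by
    let f : K →+ ZMod 2 :=
      { toFun := fun α => tr (θ * α * a)
        map_zero' := by simp [tr_zero]
        map_add' := fun α β => by simp [mul_add, add_mul, tr_add] }
    split_ifs with h
    · simp [h, tr_zero, sgn_zero]
    · rcases sum_sgn_addMonoidHom f with ⟨-, h2⟩ | ⟨h1, -⟩
      · refine absurd (eq_zero_of_tr_mul fun z => ?_) h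
        rw [mul_comm, ← tr_mul_conj hc hθ ha]
        rw [← h2 ⟨z + c z, (hK _).2 (by rw [map_add, hc, add_comm])⟩]
        change _ = tr (θ * (z + c z) * a)
        congr 1
        ring
      · exact h1
  rw [h1]
  by_cases h : a = 0 <;> by_cases h' : b = 0 <;> simp [h, h']

theorem sum_expSum [Fintype F] [Fintype K] (hc : ∀ x, c (c x) = x)
    (hθ : θ + c θ = 1) (hK : ∀ x, x ∈ K ↔ c x = x) :
    ∑ p : K × F, expSum s c θ p.1 p.2 = Fintype.card K * Fintype.card F := by
  classical
  simp only [expSum, Fintype.sum_prod_type]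
  rw [Finset.sum_comm_cycle]
  simp only [quad]
  rw [Finset.sum_congr rfl fun x _ => sum_sgn_tr_pair hc hθ hK
    (a := x * c x) (b := x * s x) (by rw [map_mul, hc, mul_comm])]
  rw [Finset.sum_eq_single 0]
  · simp
  · intro x _ hx
    rw [if_neg]
    simp [hx]
  · simp

/-- Orthogonality leaves pairs with `x c(x) = y c(y)` and `x s(x) = y s(y)`. If `y ≠ 0`, the ratio
`t = x/y` satisfies `s t = c t`, so `hD` puts it in `Fix(c)`; then `t² = 1` and `t = 1`. Only the
diagonal remains. -/
theorem sum_expSum_sq [Fintype F] [Fintype K] (hc : ∀ x, c (c x) = x)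
    (hsc : ∀ x, s (c x) = c (s x))
    (hθ : θ + c θ = 1) (hK : ∀ x, x ∈ K ↔ c x = x) (hD : ∀ e, s (c e) = e → c e = e) :
    ∑ p : K × F, expSum s c θ p.1 p.2 ^ 2 = Fintype.card K * Fintype.card F ^ 2 := by
  classical
  have hinj : ∀ x y : F, x * c x + y * c y = 0 ∧ x * s x + y * s y = 0 ↔ y = x := by
    intro x y
    refine ⟨fun ⟨h1, h2⟩ => ?_, fun h => by rw [h]; exact ⟨add_self_zero _, add_self_zero _⟩⟩
    have h1 := eq_of_add_eq_zero h1
    have h2 := eq_of_add_eq_zero h2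
    by_cases hy : y = 0
    · subst hy
      have h0 : x * c x = 0 := by rw [h1, zero_mul]
      rcases mul_eq_zero.mp h0 with h | h
      · exact h.symm
      · exact ((map_eq_zero c).mp h).symm
    have hcy : c y ≠ 0 := by simpa using hy
    have hsy : s y ≠ 0 := by simpa using hy
    have h3 : x / y * c (x / y) = 1 := by
      rw [map_div₀, div_mul_div_comm, h1, div_self (mul_ne_zero hy hcy)]
    have h4 : x / y * s (x / y) = 1 := by
      rw [map_div₀, div_mul_div_comm, h2, div_self (mul_ne_zero hy hsy)]
    set t := x / y with ht
    have ht0 : t ≠ 0 := left_ne_zero_of_mul_eq_one h3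
    have h5 : s t = c t := mul_left_cancel₀ ht0 (h4.trans h3.symm)
    have h6 : c t = t := hD t (by rw [hsc, h5, hc])
    rw [h6] at h3
    have h7 : (t - 1) ^ 2 = 0 := by
      linear_combination h3 - (t - 1) * two_eq_zero (F := F)
    have h8 : t = 1 := sub_eq_zero.mp (pow_eq_zero_iff two_ne_zero |>.mp h7)
    rw [ht, div_eq_one_iff_eq hy] at h8
    exact h8.symm
  have h : ∀ p : K × F, expSum s c θ p.1 p.2 ^ 2 = ∑ z : F × F,
      sgn (tr (θ * p.1 * (z.1 * c z.1 + z.2 * c z.2) + p.2 * (z.1 * s z.1 + z.2 * s z.2))) := by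
    intro p
    rw [sq, expSum, Finset.sum_mul_sum, Fintype.sum_prod_type]
    refine Finset.sum_congr rfl fun x _ => Finset.sum_congr rfl fun y _ => ?_
    rw [← sgn_add, quad, quad, ← tr_add]
    congr 2
    ring
  simp only [h]
  rw [Finset.sum_comm]
  simp only [Fintype.sum_prod_type (α₁ := K)]
  rw [Finset.sum_congr rfl fun z _ => sum_sgn_tr_pair hc hθ hK
    (a := z.1 * c z.1 + z.2 * c z.2) (b := z.1 * s z.1 + z.2 * s z.2)
    (by simp only [map_add, map_mul, hc]; ring)]
  simp only [hinj, Fintype.sum_prod_type, Finset.sum_ite_eq', Finset.mem_univ, if_true,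
    Finset.sum_const, nsmul_eq_mul, Finset.card_univ]
  ring

/-- Put `g = β x s(x)`. Then `α x c(x) = g + s⁻¹ g` is solvable with `α` in `K` exactly when `w = g
+ c g` is fixed by `s` (it always is by `c`). Such `g` are uniquely `a + θ w` with `a` in `K`. -/
theorem card_polarMap_eq_zero [Finite F] (hc : ∀ x, c (c x) = x)
    (hsc : ∀ x, s (c x) = c (s x)) (hθ : θ + c θ = 1) (hK : ∀ x, x ∈ K ↔ c x = x)
    {x : F} (hx : x ≠ 0) :
    Nat.card {p : K × F // polarMap s c p.1 p.2 x = 0} =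
      Nat.card K * Nat.card {e : F // s e = e ∧ c e = e} := by
  have hcx : c x ≠ 0 := by simpa using hx
  have hsx : s x ≠ 0 := by simpa using hx
  have hsymm : ∀ x, c (s.symm x) = s.symm (c x) := fun x => by
    rw [AlgEquiv.eq_symm_apply, hsc, AlgEquiv.apply_symm_apply]
  have hcθ : c θ = 1 + θ := by linear_combination hθ - θ * two_eq_zero (F := F)
  have hx1 : ∀ β : F, x * s.symm (β * x) = s.symm (β * x * s x) := fun β => by
    rw [map_mul s.symm (β * x), AlgEquiv.symm_apply_apply, mul_comm]
  rw [← Nat.card_prod]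
  refine Nat.card_congr
    { toFun := fun p =>
        (⟨p.1.2 * x * s x + θ * (p.1.2 * x * s x + c (p.1.2 * x * s x)), (hK _).2 ?_⟩,
         ⟨p.1.2 * x * s x + c (p.1.2 * x * s x), ?_, ?_⟩)
      invFun := fun q => ⟨(⟨(q.1 + θ * q.2 + s.symm (q.1 + θ * q.2)) / (x * c x), (hK _).2 ?_⟩,
        (q.1 + θ * q.2) / (x * s x)), ?_⟩
      left_inv := ?_
      right_inv := ?_ }
  · simp only [map_add, map_mul, hc, hcθ]
    linear_combination c p.1.2 * c x * c (s x) * two_eq_zero (F := F)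
  · obtain ⟨⟨α, β⟩, hp⟩ := p
    have hα : c (α : F) = α := (hK _).1 α.2
    simp only at hp ⊢
    have h1 : (α : F) * (x * c x) = β * x * s x + s.symm (β * x * s x) := by
      rw [polarMap_apply] at hp
      rw [← hx1]
      linear_combination x * hp - (β * x * s x + x * s.symm (β * x)) * two_eq_zero (F := F)
    have h2 := congrArg c h1
    rw [map_add, hsymm, map_mul, map_mul, hc, hα] at h2
    have h3 : s.symm (β * x * s x + c (β * x * s x)) = β * x * s x + c (β * x * s x) := by
      rw [map_add]
      linear_combination -h2 - h1 + α * x * c x * two_eq_zero (F := F)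
        - (β * x * s x + c (β * x * s x)) * two_eq_zero (F := F)
    rw [AlgEquiv.symm_apply_eq] at h3
    exact h3.symm
  · simp only [map_add, hc]
    ring
  · obtain ⟨⟨a, ha⟩, ⟨w, hw1, hw2⟩⟩ := q
    have ha' := (hK a).1 ha
    have hw3 : s.symm w = w := by rw [AlgEquiv.symm_apply_eq, hw1]
    simp only [map_div₀, map_add, map_mul, hsymm, hc, hcθ, ha', hw2, map_one, hw3]
    rw [mul_comm (c x)]
    congr 1
    linear_combination w * two_eq_zero (F := F)
  · simp only [polarMap_apply]
    rw [show (q.1 + θ * q.2) / (x * s x) * x = (q.1 + θ * q.2) / s x by field_simp]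
    rw [map_div₀, AlgEquiv.symm_apply_apply]
    field_simp
    linear_combination ((q.1 : F) + θ * q.2 + s.symm (q.1 + θ * q.2)) * two_eq_zero (F := F)
  · rintro ⟨⟨α, β⟩, hp⟩
    have h0 : β * x * s x + θ * (β * x * s x + c (β * x * s x)) +
        θ * (β * x * s x + c (β * x * s x)) = β * x * s x := by
      linear_combination θ * (β * x * s x + c (β * x * s x)) * two_eq_zero (F := F)
    have h1 : (α : F) * (x * c x) = β * x * s x + s.symm (β * x * s x) := by
      simp only [polarMap_apply] at hp
      rw [← hx1]
      linear_combination x * hp - (β * x * s x + x * s.symm (β * x)) * two_eq_zero (F := F)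
    apply Subtype.ext
    apply Prod.ext
    · apply Subtype.ext
      simp only [h0]
      rw [← h1, mul_div_cancel_right₀ _ (mul_ne_zero hx hcx)]
    · simp only [h0]
      rw [mul_assoc, mul_div_cancel_right₀ _ (mul_ne_zero hx hsx)]
  · rintro ⟨⟨a, ha⟩, ⟨w, hw1, hw2⟩⟩
    have ha' := (hK a).1 ha
    have h0 : (a + θ * w) / (x * s x) * x * s x = a + θ * w := by field_simp
    have h1 : a + θ * w + c (a + θ * w) = w := by
      simp only [map_add, map_mul, ha', hcθ, hw2]
      linear_combination (a + θ * w) * two_eq_zero (F := F)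
    apply Prod.ext
    · apply Subtype.ext
      simp only [h0, h1]
      linear_combination θ * w * two_eq_zero (F := F)
    · apply Subtype.ext
      simp only [h0, h1]

theorem sum_card_ker_polarMap [Fintype F] [Fintype K] (hc : ∀ x, c (c x) = x)
    (hsc : ∀ x, s (c x) = c (s x)) (hθ : θ + c θ = 1) (hK : ∀ x, x ∈ K ↔ c x = x) :
    ∑ p : K × F, Nat.card (polarMap s c p.1 p.2).ker =
      Fintype.card K * Fintype.card F +
        (Fintype.card F - 1) * (Fintype.card K * Nat.card {e : F // s e = e ∧ c e = e}) := by
  classical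
  have h : ∀ p : K × F, Nat.card (polarMap s c p.1 p.2).ker =
      ∑ x : F, if polarMap s c p.1 p.2 x = 0 then 1 else 0 := by
    intro p
    rw [← Finset.sum_filter, Finset.sum_const, smul_eq_mul, mul_one, ← Fintype.card_subtype,
      ← Nat.card_eq_fintype_card]
    rfl
  have h' : ∀ x : F, (∑ p : K × F, if polarMap s c p.1 p.2 x = 0 then 1 else 0) =
      Nat.card {p : K × F // polarMap s c p.1 p.2 x = 0} := by
    intro x
    rw [← Finset.sum_filter, Finset.sum_const, smul_eq_mul, mul_one, ← Fintype.card_subtype,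
      ← Nat.card_eq_fintype_card]
  simp only [h]
  rw [Finset.sum_comm, ← Finset.add_sum_erase _ _ (Finset.mem_univ 0)]
  congr 1
  · simp
  · rw [Finset.sum_congr rfl fun x hx => (h' x).trans
      (card_polarMap_eq_zero hc hsc hθ hK (Finset.ne_of_mem_erase hx)), Finset.sum_const,
      Finset.card_erase_of_mem (Finset.mem_univ _), Finset.card_univ, smul_eq_mul,
      Nat.card_eq_fintype_card (α := K)]

end Moments

/-! ### Frobenius powers and their fixed fields -/

section Frobenius

section Periodic

variable {F : Type*} [Monoid F]

theorem isPeriodicPt_sq_iff (j : ℕ) (x : F) :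
    Function.IsPeriodicPt (fun x : F => x ^ 2) j x ↔ x ^ 2 ^ j = x := by
  rw [Function.IsPeriodicPt, Function.IsFixedPt, pow_iterate]

theorem pow_two_pow_eq_self_of_dvd {i j : ℕ} (h : i ∣ j) {x : F} (hx : x ^ 2 ^ i = x) :
    x ^ 2 ^ j = x := by
  rw [← isPeriodicPt_sq_iff] at hx ⊢
  exact hx.trans_dvd h

theorem pow_two_pow_gcd_eq_self_iff {i j : ℕ} {x : F} :
    x ^ 2 ^ Nat.gcd i j = x ↔ x ^ 2 ^ i = x ∧ x ^ 2 ^ j = x := by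
  refine ⟨fun h => ⟨pow_two_pow_eq_self_of_dvd (Nat.gcd_dvd_left i j) h,
    pow_two_pow_eq_self_of_dvd (Nat.gcd_dvd_right i j) h⟩, fun ⟨h1, h2⟩ => ?_⟩
  rw [← isPeriodicPt_sq_iff] at h1 h2 ⊢
  exact h1.gcd h2

end Periodic

section Fixed

variable {F : Type*} [Field F] [Fintype F]

/-- Nonzero fixed points are the `(2^j - 1)`-th roots of unity in a cyclic group of order `2^n - 1`,
and `gcd(2^n - 1, 2^j - 1) = 2^gcd(n, j) - 1`. -/
theorem card_fixed {n j : ℕ} (hF : Fintype.card F = 2 ^ n) (hjn : j ∣ n) :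
    Nat.card {x : F // x ^ 2 ^ j = x} = 2 ^ j := by
  classical
  have h1 : (Finset.univ.filter fun x : F => x ^ 2 ^ j = x) =
      insert 0 ((Finset.univ.filter fun u : Fˣ => u ∈ (powMonoidHom (2 ^ j - 1) : Fˣ →* Fˣ).ker).map
        ⟨Units.val, Units.val_injective⟩) := by
    ext x
    simp only [Finset.mem_filter, Finset.mem_univ, true_and, Finset.mem_insert, Finset.mem_map,
      Function.Embedding.coeFn_mk, MonoidHom.mem_ker, powMonoidHom_apply]
    have h2 : 2 ^ j = 2 ^ j - 1 + 1 := by have := Nat.one_le_two_pow (n := j); omega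
    constructor
    · intro h
      by_cases hx : x = 0
      · exact Or.inl hx
      · refine Or.inr ⟨Units.mk0 x hx, ?_, rfl⟩
        rw [Units.ext_iff, Units.val_pow_eq_pow_val, Units.val_mk0, Units.val_one]
        rw [h2, pow_succ] at h
        exact mul_right_cancel₀ hx (h.trans (one_mul x).symm)
    · rintro (rfl | ⟨u, hu, rfl⟩)
      · exact zero_pow (by positivity)
      · rw [h2, pow_succ, ← Units.val_pow_eq_pow_val, hu, Units.val_one, one_mul]
  rw [Nat.card_eq_fintype_card, Fintype.card_subtype, h1, Finset.card_insert_of_notMem (by simp),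
    Finset.card_map, ← Fintype.card_subtype]
  have h3 := IsCyclic.card_powMonoidHom_ker (G := Fˣ) (2 ^ j - 1)
  rw [Nat.card_eq_fintype_card, Nat.card_eq_fintype_card, Fintype.card_units, hF,
    Nat.pow_sub_one_gcd_pow_sub_one, Nat.gcd_eq_right hjn] at h3
  have h4 := Nat.one_le_two_pow (n := j)
  have h5 : Fintype.card {u : Fˣ // u ∈ (powMonoidHom (2 ^ j - 1) : Fˣ →* Fˣ).ker} = 2 ^ j - 1 := by
    convert h3
  rw [h5]
  omega

end Fixed

variable {F : Type*} [Field F] [Fintype F] [Algebra (ZMod 2) F]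

/-- The automorphism `x ↦ x ^ (2 ^ j)`. -/
noncomputable def frob (F : Type*) [Field F] [Fintype F] [Algebra (ZMod 2) F] (j : ℕ) :
    F ≃ₐ[ZMod 2] F :=
  FiniteField.frobeniusAlgEquivOfAlgebraic (ZMod 2) F ^ j

theorem frob_apply (j : ℕ) (x : F) : frob F j x = x ^ 2 ^ j := by
  rw [frob, AlgEquiv.coe_pow, FiniteField.coe_frobeniusAlgEquivOfAlgebraic_iterate, ZMod.card]

theorem frob_comm (i j : ℕ) (x : F) : frob F i (frob F j x) = frob F j (frob F i x) := by
  simp only [frob_apply, ← pow_mul, mul_comm]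

/-- The subfield of elements fixed by `x ↦ x ^ (2 ^ j)`. -/
noncomputable def fixedSubfield (F : Type*) [Field F] [Fintype F] [Algebra (ZMod 2) F] (j : ℕ) :
    Subfield F :=
  RingHom.eqLocusField (frob F j : F →+* F) (RingHom.id F)

theorem mem_fixedSubfield {j : ℕ} {x : F} : x ∈ fixedSubfield F j ↔ x ^ 2 ^ j = x := by
  rw [← frob_apply]
  rfl

end Frobenius

/-! ### The subfield `K` and the passage to a single trace -/

section Subfield

variable {F : Type*} [Field F] [Fintype F] [Algebra (ZMod 2) F]
variable {K : IntermediateField (ZMod 2) F} {n m : ℕ}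

theorem half_pos (hK : Nat.card K = 2 ^ m) : 0 < m := by
  rw [Nat.pos_iff_ne_zero]
  rintro rfl
  have h1 := Finite.one_lt_card (α := K)
  rw [hK] at h1
  simp at h1

theorem mem_subfield_iff (hn : n = 2 * m) (hF : Fintype.card F = 2 ^ n)
    (hK : Nat.card K = 2 ^ m) (x : F) : x ∈ K ↔ frob F m x = x := by
  have h1 : ∀ x : F, x ∈ K → x ^ 2 ^ m = x := by
    intro x hx
    have : Fintype K := Fintype.ofFinite K
    have h := FiniteField.pow_card (⟨x, hx⟩ : K)
    rw [← Nat.card_eq_fintype_card, hK] at h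
    exact congrArg Subtype.val h
  have h2 : (K : Set F) ⊆ {x : F | x ^ 2 ^ m = x} := h1
  have h3 : (K : Set F) = {x : F | x ^ 2 ^ m = x} := by
    refine Set.eq_of_subset_of_ncard_le h2 ?_ (Set.toFinite _)
    have h4 := card_fixed (j := m) hF ⟨2, by omega⟩
    rw [← Nat.card_coe_set_eq, ← Nat.card_coe_set_eq]
    exact (h4.trans hK.symm).le
  rw [frob_apply]
  exact Set.ext_iff.mp h3 x

theorem frob_half_involutive (hn : n = 2 * m) (hF : Fintype.card F = 2 ^ n) (x : F) :
    frob F m (frob F m x) = x := by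
  rw [frob_apply, frob_apply, ← pow_mul, ← pow_add, ← two_mul, ← hn, ← hF, FiniteField.pow_card]

theorem exists_add_conj_eq_one (hn : n = 2 * m) (hF : Fintype.card F = 2 ^ n)
    (hK : Nat.card K = 2 ^ m) : ∃ θ : F, θ + frob F m θ = 1 := by
  have hm := half_pos hK
  obtain ⟨z, hz⟩ : ∃ z : F, z ∉ K := by
    by_contra! h
    have h1 : K = ⊤ := by
      ext x
      simpa using h x
    have h2 : Nat.card K = Nat.card F := by
      rw [h1]
      exact Nat.card_congr IntermediateField.topEquiv.toEquiv
    rw [hK, Nat.card_eq_fintype_card, hF] at h2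
    have := Nat.pow_right_injective le_rfl h2
    omega
  rw [mem_subfield_iff hn hF hK] at hz
  have hw : z + frob F m z ≠ 0 := fun h => hz (eq_of_add_eq_zero h).symm
  refine ⟨z / (z + frob F m z), ?_⟩
  rw [map_div₀, map_add, frob_half_involutive hn hF, add_comm (frob F m z) z, ← add_div,
    div_self hw]

/-- Transitivity of the trace, with `Tr_{F/K}(θ) = θ + θ^(2^m) = 1`. -/
theorem trace_subfield_eq (hn : n = 2 * m) (hF : Fintype.card F = 2 ^ n)
    (hK : Nat.card K = 2 ^ m) {θ : F} (hθ : θ + frob F m θ = 1) (a : K) :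
    Algebra.trace (ZMod 2) K a = tr (θ * a) := by
  have hfin : Module.finrank K F = 2 := by
    have h := Module.natCard_eq_pow_finrank (K := K) (V := F)
    rw [hK, Nat.card_eq_fintype_card, hF, ← pow_mul, hn] at h
    have h1 := Nat.pow_right_injective le_rfl h
    have hm := half_pos hK
    rw [mul_comm] at h1
    exact (Nat.eq_of_mul_eq_mul_left hm h1).symm
  have h1 : Algebra.trace K F θ = 1 := by
    apply (algebraMap K F).injective
    rw [FiniteField.algebraMap_trace_eq_sum_pow, hfin, hK, map_one, Finset.sum_range_succ,
      Finset.sum_range_one, pow_zero, pow_one, pow_one, ← frob_apply, hθ]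
  have h2 := Algebra.trace_trace (R := ZMod 2) (S := K) (θ * (a : F))
  have h3 : θ * (a : F) = a • θ := mul_comm _ _
  rw [tr, ← h2, h3, map_smul, h1, smul_eq_mul, mul_one]

theorem traceForm_eq_quad (hn : n = 2 * m) (hF : Fintype.card F = 2 ^ n)
    (hK : Nat.card K = 2 ^ m) (k : ℕ) {θ : F} (hθ : θ + frob F m θ = 1) (α : K) (β x : F) :
    traceForm hn hF hK k α β x = quad (frob F k) (frob F m) θ α β x := by
  rw [traceForm, trace_subfield_eq hn hF hK hθ, quad, tr_add]
  simp only [frob_apply, powSub, ← pow_succ', tr, mul_assoc]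
  rfl

theorem T_eq_expSum (hn : n = 2 * m) (hF : Fintype.card F = 2 ^ n)
    (hK : Nat.card K = 2 ^ m) (k : ℕ) {θ : F} (hθ : θ + frob F m θ = 1) (α : K) (β : F) :
    T hn hF hK k α β = expSum (frob F k) (frob F m) θ α β :=
  Finset.sum_congr rfl fun x _ => by rw [traceForm_eq_quad hn hF hK k hθ]; rfl

end Subfield

/-! ### Possible values of the exponential sum -/

section Values

variable {F : Type*} [Field F] [Fintype F] [Algebra (ZMod 2) F]

/-- By pigeonhole, two radical vectors share the value of `x ↦ β s(x) x + c(β s(x) x)`. Their sum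
works: the cross terms are an element of `Fix(s ∘ c)` plus its `c`-conjugate, which cancel by `hD`.
-/
theorem exists_mem_ker_norm_fixed {s c : F ≃ₐ[ZMod 2] F} {α β : F} (hc : ∀ x, c (c x) = x)
    (hsc : ∀ x, s (c x) = c (s x)) (hα : c α = α) (hD : ∀ e, s (c e) = e → c e = e)
    (h : Nat.card {e : F // s (c e) = e} < Nat.card (polarMap s c α β).ker) :
    ∃ x, x ≠ 0 ∧ polarMap s c α β x = 0 ∧ c (β * x * s x) = β * x * s x := by
  let g : (polarMap s c α β).ker → {e : F // s (c e) = e} := fun x =>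
    ⟨β * s x * x + c (β * s x * x), pairing_semilinear_fixed hc hsc hα x.2 x.2⟩
  have hg : ¬ Function.Injective g := fun hg =>
    absurd (Nat.card_le_card_of_injective g hg) (not_le.mpr h)
  simp only [Function.Injective, not_forall] at hg
  obtain ⟨⟨x, hx⟩, ⟨y, hy⟩, hxy, hne⟩ := hg
  have h1 : β * s x * x + c (β * s x * x) = β * s y * y + c (β * s y * y) :=
    congrArg Subtype.val hxy
  have h2 := hD _ (pairing_semilinear_fixed hc hsc hα hx hy)
  rw [map_add, hc] at h2
  refine ⟨x + y, fun h0 => hne (Subtype.ext (eq_of_add_eq_zero h0)), ?_, ?_⟩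
  · rw [map_add, show polarMap s c α β x = 0 from hx, show polarMap s c α β y = 0 from hy,
      add_zero]
  · simp only [map_add, map_mul] at h1 h2 ⊢
    linear_combination h1 + h2 +
      (c β * c (s y) * c y + c β * c (s x) * c y - β * s x * x - β * s x * y)
        * two_eq_zero (F := F)

variable {n m k d d' : ℕ}

/-- Since `2m = n`, this identifies `d'` with `gcd(m + k, n)`, the degree of the fixed field of `s ∘
c`. -/
theorem gcd_add_two_mul (m k : ℕ) : Nat.gcd (m + k) (2 * k) = Nat.gcd (m + k) (2 * m) := by
  apply Nat.dvd_antisymm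
  · refine Nat.dvd_gcd (Nat.gcd_dvd_left _ _) ?_
    have h1 : Nat.gcd (m + k) (2 * k) ∣ 2 * k + 2 * m := by
      rw [← mul_add, add_comm k]
      exact (Nat.gcd_dvd_left _ _).mul_left 2
    exact (Nat.dvd_add_right (Nat.gcd_dvd_right _ _)).mp h1
  · refine Nat.dvd_gcd (Nat.gcd_dvd_left _ _) ?_
    have h1 : Nat.gcd (m + k) (2 * m) ∣ 2 * m + 2 * k := by
      rw [← mul_add]
      exact (Nat.gcd_dvd_left _ _).mul_left 2
    exact (Nat.dvd_add_right (Nat.gcd_dvd_right _ _)).mp h1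

theorem frob_frob_eq_self_iff (hn : n = 2 * m) (hF : Fintype.card F = 2 ^ n)
    (hd' : d' = Nat.gcd (m + k) (2 * k)) (x : F) :
    frob F k (frob F m x) = x ↔ x ^ 2 ^ d' = x := by
  rw [frob_apply, frob_apply, ← pow_mul, ← pow_add, hd', gcd_add_two_mul, ← hn,
    pow_two_pow_gcd_eq_self_iff, ← hF, FiniteField.pow_card]
  simp

theorem card_frob_frob_fixed (hn : n = 2 * m) (hF : Fintype.card F = 2 ^ n)
    (hd' : d' = Nat.gcd (m + k) (2 * k)) :
    Nat.card {x : F // frob F k (frob F m x) = x} = 2 ^ d' := by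
  simp only [frob_frob_eq_self_iff hn hF hd']
  apply card_fixed hF
  rw [hd', gcd_add_two_mul, hn]
  exact Nat.gcd_dvd_right _ _

theorem card_frob_fixed (hn : n = 2 * m) (hF : Fintype.card F = 2 ^ n)
    (hd : d = Nat.gcd m k) :
    Nat.card {x : F // frob F k x = x ∧ frob F m x = x} = 2 ^ d := by
  simp only [frob_apply, ← pow_two_pow_gcd_eq_self_iff]
  rw [Nat.gcd_comm, ← hd]
  apply card_fixed hF
  rw [hd, hn]
  exact (Nat.gcd_dvd_left _ _).mul_left 2

/-- The square identity forces the exponent to be a multiple of `2d`, and the pairing bound forces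
it to be at most `2d'`. -/
theorem card_ker_frob (hn : n = 2 * m) (hF : Fintype.card F = 2 ^ n) (hm : 0 < m)
    (hd : d = Nat.gcd m k) (hd' : d' = Nat.gcd (m + k) (2 * k))
    {θ : F} (hθ : θ + frob F m θ = 1) {α β : F} (hα : frob F m α = α) (h : ¬ (α = 0 ∧ β = 0)) :
    ∃ t, Nat.card (polarMap (frob F k) (frob F m) α β).ker = 2 ^ (2 * d * t) ∧
      d * t ≤ d' := by
  have hc := frob_half_involutive hn hF
  have hle : Nat.card (polarMap (frob F k) (frob F m) α β).ker ≤ 2 ^ (2 * d') := by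
    by_cases hβ : β = 0
    · subst hβ
      rw [card_ker_polarMap_zero_right (by simpa using h)]
      exact Nat.one_le_two_pow
    · have := card_ker_polarMap_le hc (frob_comm k m) hα hβ
      rwa [card_frob_frob_fixed hn hF hd', ← pow_mul, mul_comm] at this
  have hL : ∀ e ∈ fixedSubfield F d, frob F k e = e ∧ frob F m e = e := by
    intro e he
    rw [mem_fixedSubfield, hd, pow_two_pow_gcd_eq_self_iff] at he
    rw [frob_apply, frob_apply]
    exact he.symm
  obtain ⟨j, hj⟩ := exists_card_ker_polarMap_mul (β := β) hc hθ hα _ hL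
  have hLc : Nat.card (fixedSubfield F d) = 2 ^ d := by
    rw [← card_frob_fixed hn hF hd]
    refine Nat.card_congr (Equiv.subtypeEquivRight fun x => ?_)
    rw [mem_fixedSubfield, hd, pow_two_pow_gcd_eq_self_iff, frob_apply, frob_apply, and_comm]
  rw [hLc, hF, ← pow_mul, ← pow_mul, ← mul_assoc] at hj
  obtain ⟨m', hm'⟩ : d ∣ m := hd ▸ Nat.gcd_dvd_left m k
  have h1 : n ≤ d * j * 2 := by
    rw [← Nat.pow_dvd_pow_iff_le_right (x := 2) (by norm_num), ← hj]
    exact Dvd.intro _ rfl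
  have h2 : Nat.card (polarMap (frob F k) (frob F m) α β).ker = 2 ^ (2 * d * (j - m')) := by
    apply Nat.eq_of_mul_eq_mul_left (show 0 < 2 ^ n by positivity)
    rw [hj, ← pow_add]
    congr 1
    have hjm : m' ≤ j := by
      have hdpos : 0 < d := Nat.pos_of_ne_zero fun h0 => by simp [h0] at hm'; omega
      have h3 : d * m' ≤ d * j := by rw [← hm']; omega
      exact Nat.le_of_mul_le_mul_left h3 hdpos
    obtain ⟨i, rfl⟩ := Nat.exists_eq_add_of_le hjm
    rw [hn, hm', Nat.add_sub_cancel_left]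
    ring
  refine ⟨j - m', h2, ?_⟩
  rw [h2, Nat.pow_le_pow_iff_right (by norm_num)] at hle
  rw [mul_assoc] at hle
  omega

theorem expSum_cases_of_eq (hn : n = 2 * m) (hF : Fintype.card F = 2 ^ n) (hm : 0 < m)
    (hd : d = Nat.gcd m k) (hd' : d = Nat.gcd (m + k) (2 * k))
    {θ : F} (hθ : θ + frob F m θ = 1) {α β : F} (hα : frob F m α = α) (h : ¬ (α = 0 ∧ β = 0)) :
    ((expSum (frob F k) (frob F m) θ α β = 2 ^ m ∨
        expSum (frob F k) (frob F m) θ α β = -2 ^ m) ∧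
      Nat.card (polarMap (frob F k) (frob F m) α β).ker = 1) ∨
    ((expSum (frob F k) (frob F m) θ α β = 0 ∨
        expSum (frob F k) (frob F m) θ α β = -2 ^ (m + d)) ∧
      Nat.card (polarMap (frob F k) (frob F m) α β).ker = 2 ^ (2 * d)) := by
  have hc := frob_half_involutive hn hF
  have hdpos : 0 < d := hd ▸ Nat.gcd_pos_of_pos_left _ hm
  obtain ⟨t, ht, htd⟩ := card_ker_frob hn hF hm hd hd' hθ hα h
  have ht1 : t ≤ 1 := Nat.le_of_mul_le_mul_left (by rwa [mul_one]) hdpos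
  interval_cases t
  · left
    refine ⟨?_, by simpa using ht⟩
    have := expSum_sq_of_ker_card_eq_one hc hθ hα (by simpa using ht)
    rw [hF, hn, Nat.cast_pow, mul_comm, pow_mul, sq_eq_sq_iff_eq_or_eq_neg] at this
    exact_mod_cast this
  · right
    rw [mul_one] at ht
    refine ⟨?_, ht⟩
    rcases expSum_sq_eq hc hθ hα (s := frob F k) (β := β) with h0 | h0
    · exact Or.inl h0
    · right
      rw [ht, hF, hn] at h0
      have h1 : expSum (frob F k) (frob F m) θ α β ^ 2 = (2 ^ (m + d)) ^ 2 := by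
        rw [h0]; push_cast; ring
      rw [sq_eq_sq_iff_eq_or_eq_neg] at h1
      refine h1.resolve_left fun h2 => ?_
      have hD : ∀ e, frob F k (frob F m e) = e → frob F m e = e := by
        intro e he
        rw [frob_frob_eq_self_iff hn hF hd'] at he
        rw [frob_apply]
        exact pow_two_pow_eq_self_of_dvd (hd ▸ Nat.gcd_dvd_left m k) he
      have hβ : β ≠ 0 := by
        rintro rfl
        rw [card_ker_polarMap_zero_right (by simpa using h)] at ht
        have := Nat.one_lt_two_pow (n := 2 * d) (by omega)
        omega
      -- The radical has `2^(2d)` elements while `Fix(s ∘ c)` has only `2^d`, so the pigeonhole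
      -- lemma applies.
      obtain ⟨x, hx0, hx, hγ⟩ := exists_mem_ker_norm_fixed hc (frob_comm k m) hα hD (by
        rw [ht, card_frob_frob_fixed hn hF hd']
        exact Nat.pow_lt_pow_right (by norm_num) (by omega))
      have hneg := expSum_nonpos (N := 2 ^ m) (le_self_pow₀ (by norm_num) hm.ne')
        (by rw [hF, hn, mul_comm, pow_mul]) (frob_apply m) hc (frob_comm k m) hθ hD hx0 hβ hx hγ
      rw [h2] at hneg
      have : (0 : ℤ) < 2 ^ (m + d) := by positivity
      omega

/-- Divisibility of `m + k` by `2d` makes `m/d + k/d` even; these quotients are coprime, so both are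
odd. -/
theorem odd_div_of_gcd_eq_two_mul (hm : 0 < m) (hd : d = Nat.gcd m k)
    (hd' : 2 * d = Nat.gcd (m + k) (2 * k)) :
    (∃ a, Odd a ∧ m = d * a) ∧ ∃ b, Odd b ∧ k = d * b := by
  have hdpos : 0 < d := hd ▸ Nat.gcd_pos_of_pos_left _ hm
  obtain ⟨a, b, hab, ha, hb⟩ := Nat.exists_coprime m k
  rw [← hd, mul_comm] at ha hb
  have h1 : 2 * d ∣ m + k := hd' ▸ Nat.gcd_dvd_left _ _
  rw [ha, hb, ← mul_add, mul_comm 2] at h1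
  have h2 : 2 ∣ a + b := Nat.dvd_of_mul_dvd_mul_left hdpos h1
  have h3 : ¬ (2 ∣ a ∧ 2 ∣ b) := fun ⟨h, h'⟩ => by
    have := Nat.dvd_gcd h h'
    rw [hab.gcd_eq_one] at this
    omega
  refine ⟨⟨a, ?_, ha⟩, b, ?_, hb⟩ <;> rw [Nat.odd_iff] <;> omega

theorem expSum_cases_of_eq_two_mul (hn : n = 2 * m) (hF : Fintype.card F = 2 ^ n) (hm : 0 < m)
    (hd : d = Nat.gcd m k) (hd' : 2 * d = Nat.gcd (m + k) (2 * k))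
    {θ : F} (hθ : θ + frob F m θ = 1) {α β : F} (hα : frob F m α = α) (h : ¬ (α = 0 ∧ β = 0)) :
    (expSum (frob F k) (frob F m) θ α β = -2 ^ m ∨
      expSum (frob F k) (frob F m) θ α β = 2 ^ (m + d) ∨
      expSum (frob F k) (frob F m) θ α β = -2 ^ (m + 2 * d)) ∧
    expSum (frob F k) (frob F m) θ α β ^ 2 =
      2 ^ n * Nat.card (polarMap (frob F k) (frob F m) α β).ker := by
  have hc := frob_half_involutive hn hF
  have hdpos : 0 < d := hd ▸ Nat.gcd_pos_of_pos_left _ hm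
  obtain ⟨⟨a, ha, hma⟩, b, hb, hkb⟩ := odd_div_of_gcd_eq_two_mul hm hd hd'
  have hrm : 2 ^ d + 1 ∣ 2 ^ m + 1 := by
    have := ha.nat_add_dvd_pow_add_pow (2 ^ d) 1
    rwa [one_pow, ← pow_mul, ← hma] at this
  have hrk : 2 ^ d + 1 ∣ 2 ^ k + 1 := by
    have := hb.nat_add_dvd_pow_add_pow (2 ^ d) 1
    rwa [one_pow, ← pow_mul, ← hkb] at this
  have hdvd : ((2 ^ d + 1 : ℕ) : ℤ) ∣ expSum (frob F k) (frob F m) θ α β - 1 := by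
    have := dvd_sum_sub_of_invariant (fun x => sgn (quad (frob F k) (frob F m) θ α β x))
      (2 ^ d + 1) (by
        rw [hF, hn, mul_comm, pow_mul]
        refine hrm.trans ⟨2 ^ m - 1, by simpa using Nat.sq_sub_sq (2 ^ m) 1⟩) (by
        intro t x ht
        have h1 : ∀ j, 2 ^ d + 1 ∣ 2 ^ j + 1 → t * frob F j t = 1 := by
          rintro j ⟨i, hi⟩
          rw [frob_apply, ← pow_succ', hi, pow_mul, ht, one_pow]
        have hm1 := h1 m hrm
        have hk1 := h1 k hrk
        simp only [quad]
        congr 2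
        rw [map_mul, map_mul]
        linear_combination θ * α * x * frob F m x * hm1 + β * x * frob F k x * hk1)
    rw [quad_zero, sgn_zero] at this
    exact this
  push_cast at hdvd
  have hrm' : (2 ^ d + 1 : ℤ) ∣ 2 ^ m + 1 := by exact_mod_cast hrm
  have hdpow : (2 : ℤ) ≤ 2 ^ d := le_self_pow₀ (by norm_num) hdpos.ne'
  -- Modulo `2^d + 1` one has `2^d ≡ 2^m ≡ -1`. A zero sum, or a wrong sign in any of the three
  -- cases, would make the modulus divide `2`.
  have hne2 : ¬ (2 ^ d + 1 : ℤ) ∣ 2 := fun h2 => by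
    have := Int.le_of_dvd (by norm_num) h2
    omega
  have hne0 : expSum (frob F k) (frob F m) θ α β ≠ 0 := by
    intro h0
    rw [h0] at hdvd
    apply hne2
    have := hdvd.mul_left (-2)
    norm_num at this
    exact this
  have hsq := (expSum_sq_eq hc hθ hα (s := frob F k) (β := β)).resolve_left hne0
  rw [hF] at hsq
  push_cast at hsq
  refine ⟨?_, hsq⟩
  obtain ⟨t, ht, htd⟩ := card_ker_frob hn hF hm hd hd' hθ hα h
  have ht1 : t ≤ 2 := Nat.le_of_mul_le_mul_left (by rwa [mul_comm d 2]) hdpos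
  have h1 : expSum (frob F k) (frob F m) θ α β ^ 2 = (2 ^ (m + d * t)) ^ 2 := by
    rw [hsq, ht, hn]; push_cast; ring
  rw [sq_eq_sq_iff_eq_or_eq_neg] at h1
  interval_cases t
  · left
    rw [mul_zero, add_zero] at h1
    refine h1.resolve_left fun h2 => hne2 ?_
    rw [h2] at hdvd
    have := dvd_sub hrm' hdvd
    rwa [show (2 : ℤ) ^ m + 1 - (2 ^ m - 1) = 2 by ring] at this
  · right; left
    rw [mul_one] at h1
    refine h1.resolve_right fun h2 => hne2 ?_
    rw [h2] at hdvd
    have := dvd_add (dvd_add hdvd (hrm'.mul_left (2 ^ d))) (dvd_neg.mpr (dvd_refl (2 ^ d + 1 : ℤ)))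
    rw [show -(2 : ℤ) ^ (m + d) - 1 + 2 ^ d * (2 ^ m + 1) + -(2 ^ d + 1) = -2 by ring] at this
    exact (dvd_neg).mp this
  · right; right
    rw [mul_comm d 2] at h1
    refine h1.resolve_left fun h2 => hne2 ?_
    rw [h2] at hdvd
    have := dvd_sub (hrm'.mul_left (2 ^ (2 * d)))
      (dvd_add hdvd ((dvd_refl (2 ^ d + 1 : ℤ)).mul_left (2 ^ d - 1)))
    rwa [show (2 : ℤ) ^ (2 * d) * (2 ^ m + 1) -
      (2 ^ (m + 2 * d) - 1 + (2 ^ d - 1) * (2 ^ d + 1)) = 2 by ring] at this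

end Values

/-! ### Powers of a primitive element -/

section Primitive

variable {F : Type*} [Field F] [Fintype F] {n : ℕ}

theorem orderOf_primitive (hF : Fintype.card F = 2 ^ n) {π : Fˣ}
    (hπ : ∀ y : Fˣ, y ∈ Subgroup.zpowers π) : orderOf π = 2 ^ n - 1 := by
  classical
  rw [orderOf_eq_card_of_forall_mem_zpowers hπ, Nat.card_eq_fintype_card, Fintype.card_units, hF]

theorem bijective_primitive_pow (hF : Fintype.card F = 2 ^ n) {π : Fˣ}
    (hπ : ∀ y : Fˣ, y ∈ Subgroup.zpowers π) :
    Function.Bijective fun i : Fin (2 ^ n - 1) => π ^ (i : ℕ) := by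
  classical
  rw [Fintype.bijective_iff_injective_and_card]
  refine ⟨fun i j hij => Fin.ext ?_, by rw [Fintype.card_fin, Fintype.card_units, hF]⟩
  have ho := orderOf_primitive hF hπ
  exact pow_injOn_Iio_orderOf (by rw [ho]; exact i.2) (by rw [ho]; exact j.2) hij

end Primitive

/-! ### The cyclic code and the encoding map -/

section Code

variable {F : Type*} [Field F] [Fintype F] [Algebra (ZMod 2) F]
variable {K : IntermediateField (ZMod 2) F} {n m : ℕ}

theorem T_eq_sub_hammingNorm (hn : n = 2 * m) (hF : Fintype.card F = 2 ^ n)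
    (hK : Nat.card K = 2 ^ m) (k : ℕ) {π : Fˣ} (hπ : ∀ y : Fˣ, y ∈ Subgroup.zpowers π)
    (α : K) (β : F) :
    T hn hF hK k α β = 2 ^ n - 2 * hammingNorm (word hn hF hK k π α β) := by
  classical
  have h0 : traceForm hn hF hK k α β 0 = 0 := by
    obtain ⟨θ, hθ⟩ := exists_add_conj_eq_one hn hF hK
    rw [traceForm_eq_quad hn hF hK k hθ, quad_zero]
  have h1 : T hn hF hK k α β = 1 + ∑ u : Fˣ, sgn (traceForm hn hF hK k α β u) := by
    rw [T, ← Finset.add_sum_erase _ _ (Finset.mem_univ 0), h0]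
    congr 1
    rw [Finset.sum_subtype (p := fun x : F => x ≠ 0) _ (by simp)]
    exact (Equiv.sum_comp unitsEquivNeZero
      (fun x : {x : F // x ≠ 0} => sgn (traceForm hn hF hK k α β x))).symm
  have h2 : ∑ u : Fˣ, sgn (traceForm hn hF hK k α β u) =
      ∑ i, sgn (word hn hF hK k π α β i) := by
    rw [← Function.Bijective.sum_comp (bijective_primitive_pow hF hπ)]
    simp [word]
  have h3 : ∀ a : ZMod 2, sgn a = 1 - 2 * if a ≠ 0 then 1 else 0 := by decide
  rw [h1, h2]
  simp only [h3, Finset.sum_sub_distrib, ← Finset.mul_sum, Finset.sum_boole, Finset.sum_const,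
    Finset.card_univ, Fintype.card_fin, nsmul_eq_mul, mul_one]
  rw [hammingNorm, Nat.cast_sub Nat.one_le_two_pow]
  push_cast
  ring

theorem word_sub (hn : n = 2 * m) (hF : Fintype.card F = 2 ^ n)
    (hK : Nat.card K = 2 ^ m) (k : ℕ) (π : Fˣ) (p q : K × F) :
    word hn hF hK k π (p - q).1 (p - q).2 =
      word hn hF hK k π p.1 p.2 - word hn hF hK k π q.1 q.2 := by
  ext i
  simp only [word, traceForm, Prod.fst_sub, Prod.snd_sub, sub_mul, map_sub, Pi.sub_apply]
  ring

theorem natDegree_wordPoly_lt {l : ℕ} (hl : 0 < l) (w : Fin l → ZMod 2) :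
    (wordPoly w).natDegree < l := by
  have h : ∀ i ∈ (Finset.univ : Finset (Fin l)), (C (w i) * X ^ (i : ℕ)).natDegree ≤ l - 1 :=
    fun i _ => (natDegree_C_mul_X_pow_le _ _).trans (by omega)
  have := natDegree_sum_le_of_forall_le Finset.univ _ h
  rw [wordPoly]
  omega

theorem wordPoly_injective {l : ℕ} : Function.Injective (wordPoly (l := l)) := by
  intro v w h
  have key : ∀ (u : Fin l → ZMod 2) (j : Fin l), (wordPoly u).coeff j = u j := by
    intro u j
    simp [wordPoly, finsetSum_coeff, coeff_C_mul, coeff_X_pow, Fin.val_inj]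
  ext j
  rw [← key v, ← key w, h]

/-- A cyclic code has at most `2 ^ N` words if its parity-check polynomial has degree at most
`N`. -/
theorem ncard_cyclicCode_le {l : ℕ} (hl : 0 < l) {h : (ZMod 2)[X]} (h0 : h ≠ 0) {N : ℕ}
    (hN : h.natDegree ≤ N) : (cyclicCode l h : Set (Fin l → ZMod 2)).ncard ≤ 2 ^ N := by
  have hX : (X ^ l - 1 : (ZMod 2)[X]) ≠ 0 := X_pow_sub_C_ne_zero hl 1
  have hmem : ∀ w : cyclicCode l h, ∃ q, wordPoly w.1 * h = (X ^ l - 1) * q := fun w => w.2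
  -- The cofactor `q w` determines `w`, and its degree is below `deg h` because `wordPoly w` has
  -- degree below `l`.
  choose q hq using hmem
  have hdeg : ∀ w, (q w).degree < N := by
    intro w
    by_cases hq0 : q w = 0
    · rw [hq0, degree_zero]
      exact WithBot.bot_lt_coe N
    have hw0 : wordPoly w.1 ≠ 0 := by
      intro hw
      have := hq w
      rw [hw, zero_mul, eq_comm, mul_eq_zero] at this
      exact this.elim hX hq0
    rw [degree_eq_natDegree hq0]
    have h1 := congrArg natDegree (hq w)
    rw [natDegree_mul hw0 h0, natDegree_mul hX hq0,
      show (X ^ l - 1 : (ZMod 2)[X]).natDegree = l from natDegree_X_pow_sub_C] at h1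
    have h2 := natDegree_wordPoly_lt hl w.1
    have : (q w).natDegree < N := by omega
    exact_mod_cast this
  have hinj : Function.Injective fun (w : cyclicCode l h) (i : Fin N) => (q w).coeff i := by
    intro v w hvw
    have h1 : q v = q w := by
      ext i
      by_cases hi : i < N
      · exact congrFun hvw ⟨i, hi⟩
      · rw [coeff_eq_zero_of_degree_lt ((hdeg v).trans_le (by exact_mod_cast not_lt.mp hi)),
          coeff_eq_zero_of_degree_lt ((hdeg w).trans_le (by exact_mod_cast not_lt.mp hi))]
    have h2 : wordPoly v.1 * h = wordPoly w.1 * h := by rw [hq, hq, h1]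
    exact Subtype.ext (wordPoly_injective (mul_right_cancel₀ h0 h2))
  have := Nat.card_le_card_of_injective _ hinj
  rw [← Nat.card_coe_set_eq]
  simpa using this

theorem finrank_eq_of_card {L : Type*} [Field L] [Finite L] [Algebra (ZMod 2) L] {j : ℕ}
    (h : Nat.card L = 2 ^ j) : Module.finrank (ZMod 2) L = j := by
  have h1 := Module.natCard_eq_pow_finrank (K := ZMod 2) (V := L)
  rw [h, Nat.card_zmod] at h1
  exact (Nat.pow_right_injective le_rfl h1).symm

theorem natDegree_parityPoly_le (hn : n = 2 * m) (hF : Fintype.card F = 2 ^ n)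
    (hK : Nat.card K = 2 ^ m) (k : ℕ) (π : Fˣ) :
    (parityPoly m k π).natDegree ≤ n + m := by
  refine natDegree_mul_le.trans (Nat.add_le_add ?_ ?_)
  · have h := minpoly.natDegree_le (A := ZMod 2) ((π : F)⁻¹ ^ (2 ^ k + 1))
    rwa [finrank_eq_of_card (by rw [Nat.card_eq_fintype_card, hF])] at h
  · have h := minpoly.natDegree_le (A := ZMod 2)
      (⟨(π : F)⁻¹ ^ (2 ^ m + 1), pow_mem_subfield hn hF hK _⟩ : K)
    rw [finrank_eq_of_card hK] at h
    rwa [← minpoly.algebraMap_eq (algebraMap K F).injective] at h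

theorem minpoly_ne_zero_of_finite (x : F) : minpoly (ZMod 2) x ≠ 0 :=
  minpoly.ne_zero (Algebra.IsIntegral.isIntegral x)

/-- The polynomial of a trace sequence vanishes at each `l`-th root of unity outside the
conjugates of the inverse of the ratio. -/
theorem sum_trace_mul_pow_eq_zero {l : ℕ} {b η y : F} (hη : η ^ l = 1) (hy : y ^ l = 1)
    (h : aeval y (minpoly (ZMod 2) η⁻¹) ≠ 0) :
    ∑ i ∈ Finset.range l, algebraMap (ZMod 2) F (tr (b * η ^ i)) * y ^ i = 0 := by
  simp only [tr, FiniteField.algebraMap_trace_eq_sum_pow, Nat.card_zmod, Finset.sum_mul]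
  rw [Finset.sum_comm]
  refine Finset.sum_eq_zero fun t _ => ?_
  have h1 : ∀ i ∈ Finset.range l,
      (b * η ^ i) ^ 2 ^ t * y ^ i = b ^ 2 ^ t * (η ^ 2 ^ t * y) ^ i := by
    intro i _
    rw [mul_pow, mul_pow, ← pow_mul, ← pow_mul, mul_comm i, mul_assoc]
  rw [Finset.sum_congr rfl h1, ← Finset.mul_sum]
  -- Ratio `1` would make `y` a conjugate of `η⁻¹`, hence a root of its minimal polynomial.
  -- Otherwise the geometric sum vanishes.
  have h2 : η ^ 2 ^ t * y ≠ 1 := by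
    intro h3
    have h4 : y = frob F t η⁻¹ := by
      rw [frob_apply, inv_pow]
      exact eq_inv_of_mul_eq_one_right h3
    apply h
    rw [h4]
    have := aeval_algHom_apply (frob F t : F →ₐ[ZMod 2] F) η⁻¹ (minpoly (ZMod 2) η⁻¹)
    rw [minpoly.aeval, map_zero] at this
    exact this
  have h3 : (η ^ 2 ^ t * y) ^ l = 1 := by
    rw [mul_pow, hy, mul_one, ← pow_mul, mul_comm, pow_mul, hη, one_pow]
  have h4 := mul_neg_geom_sum (η ^ 2 ^ t * y) l
  rw [h3, sub_self, mul_eq_zero] at h4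
  rw [h4.resolve_left (sub_ne_zero.mpr h2.symm), mul_zero]

/-- `X^l - 1` splits into distinct linear factors over `F`, so it suffices to test each `l`-th root
of unity: either a minimal polynomial vanishes there, or both trace sequences do. -/
theorem word_mem_codeC1 (hn : n = 2 * m) (hF : Fintype.card F = 2 ^ n)
    (hK : Nat.card K = 2 ^ m) (k : ℕ) {π : Fˣ} (hπ : ∀ y : Fˣ, y ∈ Subgroup.zpowers π)
    (α : K) (β : F) : word hn hF hK k π α β ∈ codeC1 n m k π := by
  classical
  have hl : 0 < 2 ^ n - 1 := by
    have := half_pos hK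
    have := Nat.one_lt_two_pow (n := n) (by omega)
    omega
  set l := 2 ^ n - 1 with hldef
  obtain ⟨θ, hθ⟩ := exists_add_conj_eq_one hn hF hK
  change (X ^ l - 1 : (ZMod 2)[X]) ∣ _
  rw [← map_dvd_map' (algebraMap (ZMod 2) F)]
  have hprim : IsPrimitiveRoot (π : F) l := by
    rw [IsPrimitiveRoot.coe_units_iff, hldef, ← orderOf_primitive hF hπ]
    exact IsPrimitiveRoot.orderOf π
  rw [Polynomial.map_sub, Polynomial.map_pow, map_X, Polynomial.map_one,
    X_pow_sub_one_eq_prod hl hprim]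
  refine Finset.prod_dvd_of_coprime
    (fun a _ b _ hab => pairwise_coprime_X_sub_C Function.injective_id hab) fun y hy => ?_
  rw [mem_nthRootsFinset hl] at hy
  rw [dvd_iff_isRoot, IsRoot, eval_map_algebraMap, map_mul, parityPoly, map_mul]
  have hπ1 : ∀ j, ((π : F) ^ j) ^ l = 1 := fun j => by
    rw [← pow_mul, mul_comm, pow_mul, hprim.pow_eq_one, one_pow]
  by_cases h1 : aeval y (minpoly (ZMod 2) ((π : F)⁻¹ ^ (2 ^ k + 1))) = 0
  · rw [h1, zero_mul, mul_zero]
  by_cases h2 : aeval y (minpoly (ZMod 2) ((π : F)⁻¹ ^ (2 ^ m + 1))) = 0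
  · rw [h2, mul_zero, mul_zero]
  rw [inv_pow] at h1 h2
  have e1 := sum_trace_mul_pow_eq_zero (b := β) (hπ1 _) hy h1
  have e2 := sum_trace_mul_pow_eq_zero (b := θ * α) (hπ1 _) hy h2
  have e3 : aeval y (wordPoly (word hn hF hK k π α β)) =
      ∑ i ∈ Finset.range l, (algebraMap (ZMod 2) F (tr (θ * α * ((π : F) ^ (2 ^ m + 1)) ^ i)) * y ^ i
        + algebraMap (ZMod 2) F (tr (β * ((π : F) ^ (2 ^ k + 1)) ^ i)) * y ^ i) := by
    rw [Finset.sum_range, wordPoly, map_sum]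
    refine Finset.sum_congr rfl fun i _ => ?_
    rw [map_mul, aeval_C, map_pow, aeval_X, ← add_mul, ← map_add, word,
      traceForm_eq_quad hn hF hK k hθ, quad, tr_add, frob_apply, frob_apply, ← pow_succ',
      ← pow_succ', ← pow_mul, ← pow_mul, ← pow_mul, ← pow_mul, mul_comm (i : ℕ),
      mul_comm (i : ℕ)]
  rw [e3, Finset.sum_add_distrib, e1, e2, add_zero, zero_mul]

/-- Equal words have a difference of weight zero, so its sum is `2^n` and `hT` applies. Surjectivity
is a count, so the exact degrees of the minimal polynomials are not needed. -/
theorem bijOn_word (hn : n = 2 * m) (hF : Fintype.card F = 2 ^ n)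
    (hK : Nat.card K = 2 ^ m) (k : ℕ) {π : Fˣ} (hπ : ∀ y : Fˣ, y ∈ Subgroup.zpowers π)
    (hT : ∀ (α : K) (β : F), T hn hF hK k α β = 2 ^ n → α = 0 ∧ β = 0) :
    Set.BijOn (fun p : K × F => word hn hF hK k π p.1 p.2) Set.univ
        (codeC1 n m k π : Set (Fin (2 ^ n - 1) → ZMod 2)) := by
  have hl : 0 < 2 ^ n - 1 := by
    have := half_pos hK
    have := Nat.one_lt_two_pow (n := n) (by omega)
    omega
  have hmaps : Set.MapsTo (fun p : K × F => word hn hF hK k π p.1 p.2) Set.univ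
      (codeC1 n m k π : Set (Fin (2 ^ n - 1) → ZMod 2)) :=
    fun p _ => word_mem_codeC1 hn hF hK k hπ p.1 p.2
  have hinj : Set.InjOn (fun p : K × F => word hn hF hK k π p.1 p.2) Set.univ := by
    intro p _ q _ hpq
    have h1 := word_sub hn hF hK k π p q
    rw [sub_eq_zero.mpr hpq] at h1
    have h2 := T_eq_sub_hammingNorm hn hF hK k hπ (p - q).1 (p - q).2
    rw [h1, hammingNorm_zero, Nat.cast_zero, mul_zero, sub_zero] at h2
    have h3 := hT _ _ h2
    exact sub_eq_zero.mp (Prod.ext h3.1 h3.2)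
  refine ⟨hmaps, hinj, ?_⟩
  refine (Set.eq_of_subset_of_ncard_le hmaps.image_subset ?_ (Set.toFinite _)).ge
  rw [hinj.ncard_image, Set.ncard_univ, Nat.card_prod, hK, Nat.card_eq_fintype_card,
    hF, mul_comm, ← pow_add]
  exact ncard_cyclicCode_le hl
    (mul_ne_zero (minpoly_ne_zero_of_finite _) (minpoly_ne_zero_of_finite _))
    (natDegree_parityPoly_le hn hF hK k π)

theorem isDistributionTable_of_bijOn (hn : n = 2 * m) (hF : Fintype.card F = 2 ^ n)
    (hK : Nat.card K = 2 ^ m) (k : ℕ) {π : Fˣ} (hπ : ∀ y : Fˣ, y ∈ Subgroup.zpowers π)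
    (hbij : Set.BijOn (fun p : K × F => word hn hF hK k π p.1 p.2) Set.univ
        (codeC1 n m k π : Set (Fin (2 ^ n - 1) → ZMod 2)))
    {rows : List (ℤ × ℕ × ℚ)} (hw : ∀ r ∈ rows, r.1 = 2 ^ n - 2 * (r.2.1 : ℤ))
    (hv : ∀ (α : K) (β : F), ∃ r ∈ rows, T hn hF hK k α β = r.1)
    (hc : ∀ r ∈ rows, (({p : K × F | T hn hF hK k p.1 p.2 = r.1}.ncard : ℕ) : ℚ) = r.2.2) :
    IsDistributionTable hn hF hK k π rows := by
  have key : ∀ r ∈ rows, ∀ (α : K) (β : F),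
      T hn hF hK k α β = r.1 ↔ hammingNorm (word hn hF hK k π α β) = r.2.1 := by
    intro r hr α β
    rw [T_eq_sub_hammingNorm hn hF hK k hπ, hw r hr]
    omega
  refine ⟨fun α β => ?_, hc, fun w hwC => ?_, fun r hr => ?_⟩
  · obtain ⟨r, hr, h⟩ := hv α β
    exact ⟨r, hr, h, (key r hr α β).mp h⟩
  · obtain ⟨⟨α, β⟩, -, rfl⟩ := hbij.surjOn hwC
    obtain ⟨r, hr, h⟩ := hv α β
    exact ⟨r, hr, (key r hr α β).mp h⟩
  · rw [← hc r hr]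
    have h1 : {w | w ∈ codeC1 n m k π ∧ hammingNorm w = r.2.1} =
        (fun p : K × F => word hn hF hK k π p.1 p.2) ''
          {p : K × F | T hn hF hK k p.1 p.2 = r.1} := by
      ext w
      constructor
      · rintro ⟨hwC, hw1⟩
        obtain ⟨p, -, rfl⟩ := hbij.surjOn hwC
        exact ⟨p, (key r hr p.1 p.2).mpr hw1, rfl⟩
      · rintro ⟨p, hp, rfl⟩
        exact ⟨hbij.mapsTo (Set.mem_univ p), (key r hr p.1 p.2).mp hp⟩
    rw [h1, (hbij.injOn.mono (Set.subset_univ _)).ncard_image]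

end Code

/-! ### Solving the moment equations -/

section Distribution

theorem sum_eq_sum_map_values {ι : Type*} [Fintype ι] (f : ι → ℤ) (g : ι → ℚ) (h : ℤ → ℚ)
    {V : List ℤ} (hV : V.Nodup) (hf : ∀ i, f i ∈ V) (hg : ∀ i, g i = h (f i)) :
    ∑ i, g i = (V.map fun v => h v * ({i | f i = v}.ncard : ℚ)).sum := by
  classical
  rw [← List.sum_toFinset _ hV, ← Finset.sum_fiberwise_of_maps_to (t := V.toFinset) (g := f)
    (fun i _ => List.mem_toFinset.mpr (hf i))]
  refine Finset.sum_congr rfl fun v _ => ?_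
  rw [Finset.sum_congr rfl fun i hi => (hg i).trans (by rw [(Finset.mem_filter.mp hi).2]),
    Finset.sum_const, nsmul_eq_mul, mul_comm]
  congr 2
  rw [Set.ncard_eq_toFinset_card', Set.toFinset_ofPred]

/-- Here `A = 2^m`, `D = 2^d`, `R = 2^(m-d)`, `P = 2^(d-1)`; `a`, `b`, `e`, `z` count the values
`A`, `-A`, `-A D`, `0`. Radical sum minus second moment isolates `z`, because only vanishing sums
contribute differently to the two. -/
theorem moments_solution_of_eq {A D R P a b e z : ℚ} (hA : A = D * R) (hP : D = 2 * P)
    (hD : 2 ≤ D) (hR : 0 < R)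
    (E1 : a + b + e + z + 1 = A ^ 3) (E2 : A * a - A * b - A * D * e + A ^ 2 = A ^ 3)
    (E3 : A ^ 2 * a + A ^ 2 * b + A ^ 2 * D ^ 2 * e + A ^ 4 = A ^ 5)
    (E4 : a + b + D ^ 2 * e + D ^ 2 * z + A ^ 2 = A ^ 3 + (A ^ 2 - 1) * (A * D)) :
    a = P * (A - 1) * (A ^ 2 + 2 * A + 1) / (D + 1) ∧
    b = P * (A - 1) * (A ^ 2 - 2 * A * R + 1) / (D - 1) ∧
    e = (R - 1) * (A ^ 2 - 1) / (D ^ 2 - 1) ∧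
    z = R * (A ^ 2 - 1) := by
  have hA0 : A ≠ 0 := by rw [hA]; positivity
  have hD0 : D ≠ 0 := by positivity
  have F2 : a - b - D * e + A = A ^ 2 := by
    apply mul_left_cancel₀ hA0; linear_combination E2
  have F3 : a + b + D ^ 2 * e + A ^ 2 = A ^ 3 := by
    apply mul_left_cancel₀ (pow_ne_zero 2 hA0); linear_combination E3
  have hz : z = R * (A ^ 2 - 1) := by
    apply mul_left_cancel₀ (pow_ne_zero 2 hD0)
    linear_combination E4 - F3 + (A ^ 2 - 1) * D * hA
  have he : e * (D ^ 2 - 1) = (R - 1) * (A ^ 2 - 1) := by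
    linear_combination F3 - E1 + hz
  have h1 : D + 1 ≠ 0 := by positivity
  have h2 : D - 1 ≠ 0 := by linarith
  have h3 : D ^ 2 - 1 ≠ 0 := by
    rw [show D ^ 2 - 1 = (D + 1) * (D - 1) by ring]; exact mul_ne_zero h1 h2
  refine ⟨?_, ?_, (eq_div_iff h3).mpr he, hz⟩
  · rw [eq_div_iff h1]
    linear_combination (D + 1) / 2 * (E1 + F2) + he / 2 - (D + 1) / 2 * hz
      + (A - 1) * (A ^ 2 + 2 * A + 1) / 2 * hP + (A ^ 2 - 1) / 2 * hA
  · rw [eq_div_iff h2]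
    linear_combination (D - 1) / 2 * (E1 - F2) - he / 2 - (D - 1) / 2 * hz
      + (A - 1) * (A ^ 2 - 2 * A * R + 1) / 2 * hP - (A - 1) * (A - 1) / 2 * hA

/-- Here `S = 2^(m-2d)`, and `x`, `y`, `w` count the values `-A`, `A D`, `-A D²`, with radical
orders `1`, `D²`, `D⁴`. -/
theorem moments_solution_of_eq_two_mul {A D R S x y w : ℚ} (hA : A = D * R) (hR : R = D * S)
    (hD : 2 ≤ D) (hS : 0 < S)
    (E1 : x + y + w + 1 = A ^ 3) (E2 : -A * x + A * D * y - A * D ^ 2 * w + A ^ 2 = A ^ 3)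
    (E4 : x + D ^ 2 * y + D ^ 4 * w + A ^ 2 = A ^ 3 + (A ^ 2 - 1) * (A * D)) :
    x = D ^ 3 * (A - 1) * (A ^ 2 - R ^ 2 - R * S + A - R + 1) / ((D + 1) * (D ^ 2 - 1)) ∧
    y = D * (A ^ 2 - 1) * (A + R + S + 1) / (D + 1) ^ 2 ∧
    w = (R - 1) * (A ^ 2 - 1) / ((D + 1) * (D ^ 2 - 1)) := by
  have hA0 : A ≠ 0 := by rw [hA, hR]; positivity
  have hD0 : D ≠ 0 := by positivity
  have F2 : -x + D * y - D ^ 2 * w + A = A ^ 2 := by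
    apply mul_left_cancel₀ hA0; linear_combination E2
  have h1 : D + 1 ≠ 0 := by positivity
  have h2 : D - 1 ≠ 0 := by linarith
  have h3 : D ^ 2 - 1 ≠ 0 := by
    rw [show D ^ 2 - 1 = (D + 1) * (D - 1) by ring]; exact mul_ne_zero h1 h2
  have hw : w * ((D + 1) * (D ^ 2 - 1)) = (R - 1) * (A ^ 2 - 1) := by
    apply mul_left_cancel₀ hD0
    linear_combination E4 - E1 - (D - 1) * (E1 + F2) + (A ^ 2 - 1) * hA
  have hy : y * (D + 1) ^ 2 = D * (A ^ 2 - 1) * (A + R + S + 1) := by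
    apply mul_left_cancel₀ h2
    subst hR hA
    linear_combination (D - 1) * (D + 1) * (E1 + F2) + (D - 1) * hw
  refine ⟨?_, (eq_div_iff (pow_ne_zero 2 h1)).mpr hy, (eq_div_iff (mul_ne_zero h1 h3)).mpr hw⟩
  rw [eq_div_iff (mul_ne_zero h1 h3)]
  subst hR hA
  linear_combination (D + 1) * (D ^ 2 - 1) * E1 - (D - 1) * hy - hw

end Distribution

/-! ### Multiplicities in the two cases -/

section Tables

theorem ncard_fiber_eq_one {ι : Type*} [Zero ι] {f : ι → ℤ} {v : ℤ} (h0 : f 0 = v)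
    (h : ∀ p, p ≠ 0 → f p ≠ v) : {p | f p = v}.ncard = 1 := by
  rw [Set.ncard_eq_one]
  refine ⟨0, Set.ext fun p => ⟨fun hp => by_contra fun hne => h p hne hp, ?_⟩⟩
  rintro rfl
  exact h0

theorem coe_fst_snd_ne_zero {F : Type*} [Field F] [Algebra (ZMod 2) F]
    {K : IntermediateField (ZMod 2) F} {p : K × F} (hp : p ≠ 0) :
    ¬ ((p.1 : F) = 0 ∧ p.2 = 0) := fun h => hp (Prod.ext (Subtype.ext h.1) h.2)

variable {F : Type*} [Field F] [Fintype F] [Algebra (ZMod 2) F]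
variable {K : IntermediateField (ZMod 2) F} {n m k d : ℕ}

/-- If `d = m`, then `m` divides `k` with `0 < k < 2m`, so `k = m`. The bound separates `2^(m+d)`
from `2^n` and keeps exponents such as `m - 2d` from truncating. -/
theorem two_mul_gcd_le (hm : 0 < m) (hn : n = 2 * m) (hk1 : 1 ≤ k) (hk2 : k ≤ n - 1)
    (hkm : k ≠ m) (hd : d = Nat.gcd m k) : 2 * d ≤ m := by
  obtain ⟨a, ha⟩ : d ∣ m := hd ▸ Nat.gcd_dvd_left m k
  obtain ⟨b, hb⟩ : d ∣ k := hd ▸ Nat.gcd_dvd_right m k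
  have h0 : a ≠ 0 := by rintro rfl; omega
  have h1 : a ≠ 1 := by
    rintro rfl
    rw [mul_one] at ha
    have hb0 : b ≠ 0 := by rintro rfl; omega
    have hb1 : b ≠ 1 := by rintro rfl; omega
    have : d * 2 ≤ d * b := Nat.mul_le_mul_left d (by omega)
    omega
  rw [ha, mul_comm]
  exact Nat.mul_le_mul_left d (by omega)

theorem gcd_add_eq_or (hd : d = Nat.gcd m k) :
    Nat.gcd (m + k) (2 * k) = d ∨ Nat.gcd (m + k) (2 * k) = 2 * d := by
  have h1 : Nat.gcd (m + k) (2 * k) ∣ 2 * d := by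
    rw [hd, ← Nat.gcd_mul_left]
    exact Nat.dvd_gcd (by rw [gcd_add_two_mul]; exact Nat.gcd_dvd_right _ _) (Nat.gcd_dvd_right _ _)
  have h2 : d ∣ Nat.gcd (m + k) (2 * k) := by
    rw [hd]
    exact Nat.dvd_gcd ((Nat.gcd_dvd_left m k).add (Nat.gcd_dvd_right m k))
      ((Nat.gcd_dvd_right m k).mul_left 2)
  obtain ⟨e, he⟩ := h2
  rw [he, mul_comm d e] at h1 ⊢
  rcases Nat.eq_zero_or_pos d with h0 | h0
  · simp [h0]
  · have h3 := (Nat.dvd_prime Nat.prime_two).mp (Nat.dvd_of_mul_dvd_mul_right h0 h1)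
    rcases h3 with rfl | rfl <;> simp

theorem expSum_zero_zero (s c : F ≃ₐ[ZMod 2] F) (θ : F) :
    expSum s c θ 0 0 = Fintype.card F := by
  simp [expSum, quad, tr_zero, sgn_zero]

theorem card_ker_polarMap_zero_zero (s c : F ≃ₐ[ZMod 2] F) :
    Nat.card (polarMap s c 0 0).ker = Fintype.card F := by
  have h : (polarMap s c 0 0).ker = ⊤ := by
    rw [eq_top_iff]
    intro x _
    simp [AddMonoidHom.mem_ker, polarMap_apply]
  rw [h, AddSubgroup.card_top, Nat.card_eq_fintype_card]

theorem counts_of_eq (hn : n = 2 * m) (hF : Fintype.card F = 2 ^ n) (hK : Nat.card K = 2 ^ m)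
    (hdm : 2 * d ≤ m) (hd : d = Nat.gcd m k) (hd' : d = Nat.gcd (m + k) (2 * k)) :
    (∀ p : K × F, p ≠ 0 → T hn hF hK k p.1 p.2 ≠ 2 ^ n) ∧
    (∀ p : K × F, T hn hF hK k p.1 p.2 ∈ [2 ^ m, -2 ^ m, -2 ^ (m + d), 0, (2 ^ n : ℤ)]) ∧
    (({p : K × F | T hn hF hK k p.1 p.2 = 2 ^ m}.ncard : ℕ) : ℚ) =
      2 ^ (d - 1) * (2 ^ m - 1) * (2 ^ n + 2 ^ (m + 1) + 1) / (2 ^ d + 1) ∧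
    (({p : K × F | T hn hF hK k p.1 p.2 = -2 ^ m}.ncard : ℕ) : ℚ) =
      2 ^ (d - 1) * (2 ^ m - 1) * (2 ^ n - 2 ^ (n - d + 1) + 1) / (2 ^ d - 1) ∧
    (({p : K × F | T hn hF hK k p.1 p.2 = -2 ^ (m + d)}.ncard : ℕ) : ℚ) =
      (2 ^ (m - d) - 1) * (2 ^ n - 1) / (2 ^ (2 * d) - 1) ∧
    (({p : K × F | T hn hF hK k p.1 p.2 = 0}.ncard : ℕ) : ℚ) = 2 ^ (m - d) * (2 ^ n - 1) ∧
    (({p : K × F | T hn hF hK k p.1 p.2 = 2 ^ n}.ncard : ℕ) : ℚ) = 1 := by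
  classical
  have hm := half_pos hK
  have hdpos : 0 < d := hd ▸ Nat.gcd_pos_of_pos_left _ hm
  have hc := frob_half_involutive hn hF
  have hmemK := mem_subfield_iff hn hF hK
  obtain ⟨θ, hθ⟩ := exists_add_conj_eq_one hn hF hK
  have : Fintype K := Fintype.ofFinite K
  have hKc : Fintype.card K = 2 ^ m := by rw [← Nat.card_eq_fintype_card, hK]
  set f : K × F → ℤ := fun p => T hn hF hK k p.1 p.2 with hf
  set R : K × F → ℕ := fun p => Nat.card (polarMap (frob F k) (frob F m) (p.1 : F) p.2).ker
    with hR
  have hfe : ∀ p : K × F, f p = expSum (frob F k) (frob F m) θ p.1 p.2 :=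
    fun p => T_eq_expSum hn hF hK k hθ p.1 p.2
  have hcases : ∀ p : K × F, p ≠ 0 → ((f p = 2 ^ m ∨ f p = -2 ^ m) ∧ R p = 1) ∨
      ((f p = 0 ∨ f p = -2 ^ (m + d)) ∧ R p = 2 ^ (2 * d)) := fun p hp => by
    rw [hfe]
    exact expSum_cases_of_eq hn hF hm hd hd' hθ ((hmemK _).mp p.1.2) (coe_fst_snd_ne_zero hp)
  have hf0 : f 0 = 2 ^ n := by
    rw [hfe]
    change expSum _ _ θ 0 0 = _
    rw [expSum_zero_zero, hF]
    norm_cast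
  have hR0 : R 0 = 2 ^ n := by
    rw [← hF]
    exact card_ker_polarMap_zero_zero _ _
  have q1 : (0 : ℤ) < 2 ^ m := by positivity
  have q2 : (2 : ℤ) ^ m < 2 ^ (m + d) := pow_lt_pow_right₀ (by norm_num) (by omega)
  have q3 : (2 : ℤ) ^ (m + d) < 2 ^ n := pow_lt_pow_right₀ (by norm_num) (by omega)
  have hne : ∀ p : K × F, p ≠ 0 → f p ≠ 2 ^ n := by
    intro p hp
    rcases hcases p hp with ⟨h | h, -⟩ | ⟨h | h, -⟩ <;> rw [h] <;> omega
  have hmem : ∀ p : K × F, f p ∈ [2 ^ m, -2 ^ m, -2 ^ (m + d), 0, (2 ^ n : ℤ)] := by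
    intro p
    by_cases hp : p = 0
    · subst hp
      simp [hf0]
    · rcases hcases p hp with ⟨h | h, -⟩ | ⟨h | h, -⟩ <;> simp [h]
  have hV : [2 ^ m, -2 ^ m, -2 ^ (m + d), 0, (2 ^ n : ℤ)].Nodup := by
    simp only [List.nodup_cons, List.mem_cons, List.not_mem_nil, or_false, not_or,
      List.nodup_nil, and_true, not_false_eq_true]
    refine ⟨⟨?_, ?_, ?_, ?_⟩, ⟨?_, ?_, ?_⟩, ⟨?_, ?_⟩, ?_⟩ <;> omega
  have hN : (({p : K × F | f p = 2 ^ n}.ncard : ℕ) : ℚ) = 1 := by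
    rw [ncard_fiber_eq_one hf0 hne, Nat.cast_one]
  -- The radical order is a function of the value of the sum, so `∑ |rad|` can be expanded over the
  -- same list of values.
  let ρ : ℤ → ℚ := fun v => if v = 2 ^ n then 2 ^ n else
    if v = 0 ∨ v = -2 ^ (m + d) then 2 ^ (2 * d) else 1
  have hRρ : ∀ p, (R p : ℚ) = ρ (f p) := by
    intro p
    by_cases hp : p = 0
    · subst hp
      simp [ρ, hf0, hR0]
    · have h1 := hne p hp
      simp only [ρ, if_neg h1]
      rcases hcases p hp with ⟨h | h, hr⟩ | ⟨h, hr⟩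
      · rw [hr, if_neg (by rw [h]; omega), Nat.cast_one]
      · rw [hr, if_neg (by rw [h]; omega), Nat.cast_one]
      · rw [hr, if_pos h]
        push_cast
        rfl
  have hD : ∀ e, frob F k (frob F m e) = e → frob F m e = e := by
    intro e he
    rw [frob_frob_eq_self_iff hn hF hd'] at he
    rw [frob_apply]
    exact pow_two_pow_eq_self_of_dvd (hd ▸ Nat.gcd_dvd_left m k) he
  have m1 := sum_eq_sum_map_values f (fun _ => 1) (fun _ => 1) hV hmem fun _ => rfl
  have m2 := sum_eq_sum_map_values f (fun p => (f p : ℚ)) (fun v => (v : ℚ)) hV hmem fun _ => rfl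
  have m3 := sum_eq_sum_map_values f (fun p => (f p : ℚ) ^ 2) (fun v => (v : ℚ) ^ 2) hV hmem
    fun _ => rfl
  have m4 := sum_eq_sum_map_values f (fun p => (R p : ℚ)) ρ hV hmem hRρ
  have s2 := sum_expSum (s := frob F k) hc hθ hmemK
  have s3 := sum_expSum_sq (s := frob F k) hc (frob_comm k m) hθ hmemK hD
  have s4 := sum_card_ker_polarMap (s := frob F k) hc (frob_comm k m) hθ hmemK
  simp only [← hfe, hKc, hF] at s2 s3
  rw [card_frob_fixed hn hF hd, hKc, hF] at s4
  rw [← Int.cast_sum, s2] at m2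
  simp only [← Int.cast_pow] at m3
  rw [← Int.cast_sum, s3] at m3
  rw [← Nat.cast_sum, s4] at m4
  rw [Finset.sum_const, Finset.card_univ, Fintype.card_prod, hKc, hF] at m1
  simp only [List.map_cons, List.map_nil, List.sum_cons, List.sum_nil, hN] at m1 m2 m3 m4
  have r1 : ρ (2 ^ m) = 1 := (if_neg (by omega)).trans (if_neg (by omega))
  have r2 : ρ (-2 ^ m) = 1 := (if_neg (by omega)).trans (if_neg (by omega))
  have r3 : ρ (-2 ^ (m + d)) = 2 ^ (2 * d) :=
    (if_neg (by omega)).trans (if_pos (Or.inr rfl))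
  have r4 : ρ 0 = 2 ^ (2 * d) := (if_neg (by omega)).trans (if_pos (Or.inl rfl))
  have r5 : ρ (2 ^ n) = 2 ^ n := if_pos rfl
  rw [r1, r2, r3, r4, r5] at m4
  have hsub : ((2 ^ n - 1 : ℕ) : ℚ) = 2 ^ n - 1 := by
    rw [Nat.cast_sub Nat.one_le_two_pow]; norm_num
  have e1 : (2 : ℚ) ^ n = (2 ^ m) ^ 2 := by rw [hn, mul_comm, pow_mul]
  have e2 : (2 : ℚ) ^ m = 2 ^ d * 2 ^ (m - d) := by rw [← pow_add]; congr 1; omega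
  have e3 : (2 : ℚ) ^ d = 2 * 2 ^ (d - 1) := by rw [← pow_succ']; congr 1; omega
  have e4 : (2 : ℚ) ^ (n - d + 1) = 2 * 2 ^ m * 2 ^ (m - d) := by
    rw [← pow_succ', ← pow_add]; congr 1; omega
  have e5 : (2 : ℚ) ^ (2 * d) = (2 ^ d) ^ 2 := by rw [mul_comm, pow_mul]
  set Na : ℚ := (({p | f p = 2 ^ m}.ncard : ℕ) : ℚ)
  set Nb : ℚ := (({p | f p = -2 ^ m}.ncard : ℕ) : ℚ)
  set Ne : ℚ := (({p | f p = -2 ^ (m + d)}.ncard : ℕ) : ℚ)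
  set Nz : ℚ := (({p | f p = 0}.ncard : ℕ) : ℚ)
  rw [nsmul_eq_mul] at m1
  push_cast [hsub] at m1 m2 m3 m4
  simp only [e1, e5, pow_add] at m1 m2 m3 m4
  have sol := moments_solution_of_eq (a := Na) (b := Nb) (e := Ne) (z := Nz) e2 e3
    (le_self_pow₀ (by norm_num) hdpos.ne') (by positivity)
    (by linear_combination -m1) (by linear_combination -m2)
    (by linear_combination -m3) (by linear_combination -m4)
  refine ⟨hne, hmem, ?_, ?_, ?_, ?_, hN⟩
  · rw [sol.1, e1, pow_succ]; ring
  · rw [sol.2.1, e4, e1]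
  · rw [sol.2.2.1, e1, e5]
  · rw [sol.2.2.2, e1]

theorem counts_of_eq_two_mul (hn : n = 2 * m) (hF : Fintype.card F = 2 ^ n)
    (hK : Nat.card K = 2 ^ m) (hdm : 2 * d ≤ m) (hd : d = Nat.gcd m k)
    (hd' : 2 * d = Nat.gcd (m + k) (2 * k)) :
    (∀ p : K × F, p ≠ 0 → T hn hF hK k p.1 p.2 ≠ 2 ^ n) ∧
    (∀ p : K × F, T hn hF hK k p.1 p.2 ∈ [-2 ^ m, 2 ^ (m + d), -2 ^ (m + 2 * d), (2 ^ n : ℤ)]) ∧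
    (({p : K × F | T hn hF hK k p.1 p.2 = -2 ^ m}.ncard : ℕ) : ℚ) =
      2 ^ (3 * d) * (2 ^ m - 1) *
        (2 ^ n - 2 ^ (n - 2 * d) - 2 ^ (n - 3 * d) + 2 ^ m - 2 ^ (m - d) + 1) /
          ((2 ^ d + 1) * (2 ^ (2 * d) - 1)) ∧
    (({p : K × F | T hn hF hK k p.1 p.2 = 2 ^ (m + d)}.ncard : ℕ) : ℚ) =
      2 ^ d * (2 ^ n - 1) * (2 ^ m + 2 ^ (m - d) + 2 ^ (m - 2 * d) + 1) / (2 ^ d + 1) ^ 2 ∧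
    (({p : K × F | T hn hF hK k p.1 p.2 = -2 ^ (m + 2 * d)}.ncard : ℕ) : ℚ) =
      (2 ^ (m - d) - 1) * (2 ^ n - 1) / ((2 ^ d + 1) * (2 ^ (2 * d) - 1)) ∧
    (({p : K × F | T hn hF hK k p.1 p.2 = 2 ^ n}.ncard : ℕ) : ℚ) = 1 := by
  classical
  have hm := half_pos hK
  have hdpos : 0 < d := hd ▸ Nat.gcd_pos_of_pos_left _ hm
  have hc := frob_half_involutive hn hF
  have hmemK := mem_subfield_iff hn hF hK
  obtain ⟨θ, hθ⟩ := exists_add_conj_eq_one hn hF hK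
  have : Fintype K := Fintype.ofFinite K
  have hKc : Fintype.card K = 2 ^ m := by rw [← Nat.card_eq_fintype_card, hK]
  set f : K × F → ℤ := fun p => T hn hF hK k p.1 p.2 with hf
  have hfe : ∀ p : K × F, f p = expSum (frob F k) (frob F m) θ p.1 p.2 :=
    fun p => T_eq_expSum hn hF hK k hθ p.1 p.2
  have hcases := fun (p : K × F) (hp : p ≠ 0) =>
    expSum_cases_of_eq_two_mul hn hF hm hd hd' hθ ((hmemK _).mp p.1.2) (coe_fst_snd_ne_zero hp)
  simp only [← hfe] at hcases
  have hf0 : f 0 = 2 ^ n := by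
    rw [hfe]
    change expSum _ _ θ 0 0 = _
    rw [expSum_zero_zero, hF]
    norm_cast
  have hsq : ∀ p : K × F,
      f p ^ 2 = 2 ^ n * Nat.card (polarMap (frob F k) (frob F m) (p.1 : F) p.2).ker := by
    intro p
    by_cases hp : p = 0
    · subst hp
      have h1 : Nat.card (polarMap (frob F k) (frob F m)
          (((0 : K × F).1 : K) : F) (0 : K × F).2).ker = 2 ^ n := by
        rw [← hF]
        exact card_ker_polarMap_zero_zero _ _
      rw [h1, hf0]
      push_cast
      ring
    · exact (hcases p hp).2
  have q1 : (0 : ℤ) < 2 ^ m := by positivity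
  have q2 : (2 : ℤ) ^ m < 2 ^ (m + d) := pow_lt_pow_right₀ (by norm_num) (by omega)
  have q3 : (2 : ℤ) ^ (m + d) < 2 ^ n := pow_lt_pow_right₀ (by norm_num) (by omega)
  have q4 : (2 : ℤ) ^ m < 2 ^ (m + 2 * d) := pow_lt_pow_right₀ (by norm_num) (by omega)
  have hne : ∀ p : K × F, p ≠ 0 → f p ≠ 2 ^ n := by
    intro p hp
    rcases (hcases p hp).1 with h | h | h <;> rw [h] <;> omega
  have hmem : ∀ p : K × F, f p ∈ [-2 ^ m, 2 ^ (m + d), -2 ^ (m + 2 * d), (2 ^ n : ℤ)] := by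
    intro p
    by_cases hp : p = 0
    · subst hp
      simp [hf0]
    · rcases (hcases p hp).1 with h | h | h <;> simp [h]
  have hV : [-2 ^ m, 2 ^ (m + d), -2 ^ (m + 2 * d), (2 ^ n : ℤ)].Nodup := by
    simp only [List.nodup_cons, List.mem_cons, List.not_mem_nil, or_false, not_or,
      List.nodup_nil, and_true, not_false_eq_true]
    refine ⟨⟨?_, ?_, ?_⟩, ⟨?_, ?_⟩, ?_⟩ <;> omega
  have hN : (({p : K × F | f p = 2 ^ n}.ncard : ℕ) : ℚ) = 1 := by
    rw [ncard_fiber_eq_one hf0 hne, Nat.cast_one]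
  have m1 := sum_eq_sum_map_values f (fun _ => 1) (fun _ => 1) hV hmem fun _ => rfl
  have m2 := sum_eq_sum_map_values f (fun p => (f p : ℚ)) (fun v => (v : ℚ)) hV hmem fun _ => rfl
  have m3 := sum_eq_sum_map_values f (fun p => (f p : ℚ) ^ 2) (fun v => (v : ℚ) ^ 2) hV hmem
    fun _ => rfl
  have s2 := sum_expSum (s := frob F k) hc hθ hmemK
  have s4 := sum_card_ker_polarMap (s := frob F k) hc (frob_comm k m) hθ hmemK
  simp only [← hfe, hKc, hF] at s2
  rw [card_frob_fixed hn hF hd, hKc, hF] at s4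
  rw [← Int.cast_sum, s2] at m2
  simp only [← Int.cast_pow] at m3
  -- Every sum satisfies `T² = q |rad|` here, so the second moment is `q` times the radical sum.
  rw [← Int.cast_sum, Finset.sum_congr rfl fun p _ => hsq p, ← Finset.mul_sum, ← Nat.cast_sum,
    s4] at m3
  rw [Finset.sum_const, Finset.card_univ, Fintype.card_prod, hKc, hF] at m1
  simp only [List.map_cons, List.map_nil, List.sum_cons, List.sum_nil, hN] at m1 m2 m3
  have hsub : ((2 ^ n - 1 : ℕ) : ℚ) = 2 ^ n - 1 := by
    rw [Nat.cast_sub Nat.one_le_two_pow]; norm_num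
  have e1 : (2 : ℚ) ^ n = (2 ^ m) ^ 2 := by rw [hn, mul_comm, pow_mul]
  have e2 : (2 : ℚ) ^ m = 2 ^ d * 2 ^ (m - d) := by rw [← pow_add]; congr 1; omega
  have e3 : (2 : ℚ) ^ (m - d) = 2 ^ d * 2 ^ (m - 2 * d) := by rw [← pow_add]; congr 1; omega
  have e4 : (2 : ℚ) ^ (n - 2 * d) = (2 ^ (m - d)) ^ 2 := by
    rw [← pow_mul]; congr 1; omega
  have e5 : (2 : ℚ) ^ (2 * d) = (2 ^ d) ^ 2 := by rw [mul_comm, pow_mul]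
  have e6 : (2 : ℚ) ^ (n - 3 * d) = 2 ^ (m - d) * 2 ^ (m - 2 * d) := by
    rw [← pow_add]; congr 1; omega
  have e7 : (2 : ℚ) ^ (3 * d) = (2 ^ d) ^ 3 := by rw [mul_comm, pow_mul]
  set Nx : ℚ := (({p | f p = -2 ^ m}.ncard : ℕ) : ℚ)
  set Ny : ℚ := (({p | f p = 2 ^ (m + d)}.ncard : ℕ) : ℚ)
  set Nw : ℚ := (({p | f p = -2 ^ (m + 2 * d)}.ncard : ℕ) : ℚ)
  rw [nsmul_eq_mul] at m1
  push_cast [hsub] at m1 m2 m3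
  simp only [e1, e5, pow_add] at m1 m2 m3
  have hA0 : (2 : ℚ) ^ m ≠ 0 := by positivity
  have sol := moments_solution_of_eq_two_mul (x := Nx) (y := Ny) (w := Nw) e2 e3
    (le_self_pow₀ (by norm_num) hdpos.ne') (by positivity)
    (by linear_combination -m1) (by linear_combination -m2)
    (by
      apply mul_left_cancel₀ (pow_ne_zero 2 hA0)
      linear_combination -m3)
  refine ⟨hne, hmem, ?_, ?_, ?_, hN⟩
  · rw [sol.1, e7, e1, e4, e5, e6]
  · rw [sol.2.1, e1]
  · rw [sol.2.2, e1, e5]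

end Tables

end GenKasami

/-! ### Assembly of the tables -/

theorem mainTheorem1 {F : Type*} [Field F] [Fintype F] [Algebra (ZMod 2) F]
    (K : IntermediateField (ZMod 2) F) (n m k d d' : ℕ)
    (hn : n = 2 * m) (hk1 : 1 ≤ k) (hk2 : k ≤ n - 1) (hkm : k ≠ m)
    (hd : d = Nat.gcd m k) (hd' : d' = Nat.gcd (m + k) (2 * k))
    (hF : Fintype.card F = 2 ^ n) (hK : Nat.card K = 2 ^ m)
    (π : Fˣ) (hπ : ∀ y : Fˣ, y ∈ Subgroup.zpowers π) :
    Set.BijOn (fun p : K × F => GenKasami.word hn hF hK k π p.1 p.2) Set.univ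
        (GenKasami.codeC1 n m k π : Set (Fin (2 ^ n - 1) → ZMod 2)) ∧
    (d' = d → GenKasami.IsDistributionTable hn hF hK k π
      [ (2 ^ m, 2 ^ (n - 1) - 2 ^ (m - 1),
          2 ^ (d - 1) * (2 ^ m - 1) * (2 ^ n + 2 ^ (m + 1) + 1) / (2 ^ d + 1)),
        (-2 ^ m, 2 ^ (n - 1) + 2 ^ (m - 1),
          2 ^ (d - 1) * (2 ^ m - 1) * (2 ^ n - 2 ^ (n - d + 1) + 1) / (2 ^ d - 1)),
        (-2 ^ (m + d), 2 ^ (n - 1) + 2 ^ (m + d - 1),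
          (2 ^ (m - d) - 1) * (2 ^ n - 1) / (2 ^ (2 * d) - 1)),
        (0, 2 ^ (n - 1), 2 ^ (m - d) * (2 ^ n - 1)),
        (2 ^ n, 0, 1) ]) ∧
    (d' = 2 * d → GenKasami.IsDistributionTable hn hF hK k π
      [ (-2 ^ m, 2 ^ (n - 1) + 2 ^ (m - 1),
          2 ^ (3 * d) * (2 ^ m - 1) *
            (2 ^ n - 2 ^ (n - 2 * d) - 2 ^ (n - 3 * d) + 2 ^ m - 2 ^ (m - d) + 1) /
              ((2 ^ d + 1) * (2 ^ (2 * d) - 1))),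
        (2 ^ (m + d), 2 ^ (n - 1) - 2 ^ (m + d - 1),
          2 ^ d * (2 ^ n - 1) * (2 ^ m + 2 ^ (m - d) + 2 ^ (m - 2 * d) + 1) / (2 ^ d + 1) ^ 2),
        (-2 ^ (m + 2 * d), 2 ^ (n - 1) + 2 ^ (m + 2 * d - 1),
          (2 ^ (m - d) - 1) * (2 ^ n - 1) / ((2 ^ d + 1) * (2 ^ (2 * d) - 1))),
        (2 ^ n, 0, 1) ]) := by
  have hm := GenKasami.half_pos hK
  have hdm := GenKasami.two_mul_gcd_le hm hn hk1 hk2 hkm hd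
  have hdpos : 0 < d := hd ▸ Nat.gcd_pos_of_pos_left _ hm
  have w1 : (2 : ℤ) ^ n = 2 * 2 ^ (n - 1) := by rw [← pow_succ']; congr 1; omega
  have w2 : (2 : ℤ) ^ m = 2 * 2 ^ (m - 1) := by rw [← pow_succ']; congr 1; omega
  have w3 : (2 : ℤ) ^ (m + d) = 2 * 2 ^ (m + d - 1) := by rw [← pow_succ']; congr 1; omega
  have w4 : (2 : ℤ) ^ (m + 2 * d) = 2 * 2 ^ (m + 2 * d - 1) := by
    rw [← pow_succ']; congr 1; omega
  -- `w5` and `w6` ensure that the natural subtractions in the listed weights do not truncate.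
  have w5 : (2 : ℕ) ^ (m - 1) ≤ 2 ^ (n - 1) := Nat.pow_le_pow_right (by norm_num) (by omega)
  have w6 : (2 : ℕ) ^ (m + d - 1) ≤ 2 ^ (n - 1) := Nat.pow_le_pow_right (by norm_num) (by omega)
  have hbij : Set.BijOn (fun p : K × F => GenKasami.word hn hF hK k π p.1 p.2) Set.univ
      (GenKasami.codeC1 n m k π : Set (Fin (2 ^ n - 1) → ZMod 2)) := by
    apply GenKasami.bijOn_word hn hF hK k hπ
    intro α β h
    by_contra hne
    have hp : ((α, β) : K × F) ≠ 0 := fun h0 =>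
      hne ⟨congrArg Prod.fst h0, congrArg Prod.snd h0⟩
    rcases GenKasami.gcd_add_eq_or hd with h1 | h1
    · exact (GenKasami.counts_of_eq hn hF hK hdm hd h1.symm).1 _ hp h
    · exact (GenKasami.counts_of_eq_two_mul hn hF hK hdm hd h1.symm).1 _ hp h
  refine ⟨hbij, fun h => ?_, fun h => ?_⟩
  · obtain ⟨-, hmem, c1, c2, c3, c4, c5⟩ :=
      GenKasami.counts_of_eq hn hF hK hdm hd (h.symm.trans hd')
    refine GenKasami.isDistributionTable_of_bijOn hn hF hK k hπ hbij ?_ (fun α β => ?_) ?_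
    · simp only [List.forall_mem_cons, List.not_mem_nil, false_implies, implies_true, and_true]
      push_cast [Nat.cast_sub w5]
      refine ⟨?_, ?_, ?_, ?_, ?_⟩ <;> omega
    · have := hmem (α, β)
      simpa using this
    · simp only [List.forall_mem_cons, List.not_mem_nil, false_implies, implies_true, and_true]
      exact ⟨c1, c2, c3, c4, c5⟩
  · obtain ⟨-, hmem, c1, c2, c3, c4⟩ :=
      GenKasami.counts_of_eq_two_mul hn hF hK hdm hd (h.symm.trans hd')
    refine GenKasami.isDistributionTable_of_bijOn hn hF hK k hπ hbij ?_ (fun α β => ?_) ?_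
    · simp only [List.forall_mem_cons, List.not_mem_nil, false_implies, implies_true, and_true]
      push_cast [Nat.cast_sub w6]
      refine ⟨?_, ?_, ?_, ?_⟩ <;> omega
    · have := hmem (α, β)
      simpa using this
    · simp only [List.forall_mem_cons, List.not_mem_nil, false_implies, implies_true, and_true]
      exact ⟨c1, c2, c3, c4⟩
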